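/- Let $\Omega\subset\mathbb{R}^3$ be the convex hull of the two closed unit disks $$\{(x,y,z): x^2+(y+1)^2\le 1,\ z=0\}\quad\text{and}\quad \{(x,y,z): (y-1)^2+z^2\le 1,\ x=0\}.$$ Let $$K(\mu)=\int_0^{\pi/2}\frac{d\theta}{\sqrt{1-\mu\sin^2\theta}},\qquad E(\mu)=\int_0^{\pi/2}\sqrt{1-\mu\sin^2\theta}\,d\theta,\qquad \Pi(\nu,\mu)=\int_0^{\pi/2}\frac{d\theta}{(1-\nu\sin^2\theta)\sqrt{1-\mu\sin^2\theta}}$$ be the complete elliptic integrals of the first, second and third kinds. Then the surface area $AR_3$ of $\Omega$ (the two-dimensional Hausdorff measure of $\partial\Omega$, normalized to agree with Lebesgue measure on planes) is $$AR_3=4\int_{-2}^{-2/3}\frac{2+4v+3v^2}{(1+2v)^2}\sqrt{-\frac{1+2v+3v^2}{(2+v)(2+3v)}}\,dv=\frac43\left[9E\!\left(\tfrac19\right)-8K\!\left(\tfrac19\right)+8\,\Pi\!\left(-\tfrac13,\tfrac19\right)\right],$$ where the integral in $v$ converges absolutely. Numerically, $AR_3\approx 15.97163$, in the sense that $|AR_3-15.97163|<5\cdot10^{-6}$.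 -/

import Mathlib

open Real Set MeasureTheory

noncomputable section

/-- Complete elliptic integral of the first kind, as a function of the parameter `μ` (`μ = k ^ 2`
for the modulus `k`). -/
def ellipticK (μ : ℝ) : ℝ :=
  ∫ θ in (0 : ℝ)..(π / 2), 1 / √(1 - μ * sin θ ^ 2)

/-- Complete elliptic integral of the second kind, as a function of the parameter `μ`. -/
def ellipticE (μ : ℝ) : ℝ :=
  ∫ θ in (0 : ℝ)..(π / 2), √(1 - μ * sin θ ^ 2)

/-- Complete elliptic integral of the third kind, with characteristic `ν` and parameter `μ`. -/
def ellipticPi (ν μ : ℝ) : ℝ :=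
  ∫ θ in (0 : ℝ)..(π / 2), 1 / ((1 - ν * sin θ ^ 2) * √(1 - μ * sin θ ^ 2))

/-- The closed unit disk with centre `(0, -1, 0)` in the plane `z = 0`; the coordinates
`p 0, p 1, p 2` are `x, y, z`. -/
def horizontalDisk : Set (EuclideanSpace ℝ (Fin 3)) :=
  {p | p 0 ^ 2 + (p 1 + 1) ^ 2 ≤ 1 ∧ p 2 = 0}

/-- The closed unit disk with centre `(0, 1, 0)` in the plane `x = 0`. -/
def verticalDisk : Set (EuclideanSpace ℝ (Fin 3)) :=
  {p | (p 1 - 1) ^ 2 + p 2 ^ 2 ≤ 1 ∧ p 0 = 0}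

/-- The convex hull of the two orthogonal unit disks, which touch at the origin only. -/
def twoDiskHull : Set (EuclideanSpace ℝ (Fin 3)) :=
  convexHull ℝ (horizontalDisk ∪ verticalDisk)

/-- Surface area of a solid: the two-dimensional Hausdorff measure of its boundary, normalized to
agree with Lebesgue measure on Euclidean planes. -/
def surfaceArea (Ω : Set (EuclideanSpace ℝ (Fin 3))) : ENNReal :=
  Measure.euclideanHausdorffMeasure 2 (frontier Ω)

/-- The integrand of the single-variable integral for the surface area. -/
def areaIntegrand (v : ℝ) : ℝ :=
  (2 + 4 * v + 3 * v ^ 2) / (1 + 2 * v) ^ 2 *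
    √(-((1 + 2 * v + 3 * v ^ 2) / ((2 + v) * (2 + 3 * v))))

/-- The value `(4 / 3) [9 E(1/9) - 8 K(1/9) + 8 Π(-1/3, 1/9)]`. -/
def vogtValue : ℝ :=
  4 / 3 * (9 * ellipticE (1 / 9) - 8 * ellipticK (1 / 9) + 8 * ellipticPi (-1 / 3) (1 / 9))

end

/-! The plane n ⬝ p = 1 is a supporting plane of the horizontal disk when n₀² = 1 + 2n₁ and of the
vertical disk when n₂² = 1 - 2n₁. Adding gives n₀² + n₂² = 2, so the common supporting planes form a
circle n = (√2 cos α, cos 2α / 2, √2 sin α). Each touches either disk at one point, hence meets the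
hull in the segment joining the two contact points. These segments sweep out the boundary
(`frontier_twoDiskHull_subset`), and the open ones are pairwise disjoint (`hullBoundary_injOn`).

Each plane is tangent along its whole segment, so the cross product of the two velocities is a
multiple of n, by a factor affine in t (`gram_hullBoundary`). The area formula
`euclideanHausdorffMeasure_image_eq_lintegral_normDet` turns surface area into an integral;
integrating along the segments leaves a function of sin² 2α, and θ = 2α gives 48 times the integral
of `trigIntegrand` over [0, π/2].

The substitution v = -2 / (2 + cos θ) yields the integral in v. The elliptic combination differs
from the trigonometric integral by an exact derivative vanishing at both ends
(`integral_ellipticIntegrand`). For the numerical value, a Taylor polynomial replaces the inverse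
square root, leaving Wallis integrals and the integral of 1 / (3 + sin² θ). -/

/-! ### Area formula for injective C¹ immersions. -/

section AreaFormula

open Module Filter Topology
open scoped NNReal ENNReal

/-- The map g x ↦ f x is C-Lipschitz on g(t). Injectivity of g is not needed: where g x = g y, the
bound itself forces f x = f y. -/
theorem euclideanHausdorffMeasure_image_le_of_edist_le {X Y Z : Type*}
    [EMetricSpace Y] [MeasurableSpace Y] [BorelSpace Y]
    [EMetricSpace Z] [MeasurableSpace Z] [BorelSpace Z] {f : X → Y} {g : X → Z} {t : Set X}
    {C : ℝ≥0} (d : ℕ) (h : ∀ x ∈ t, ∀ y ∈ t, edist (f x) (f y) ≤ C * edist (g x) (g y)) :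
    μHE[d] (f '' t) ≤ (C : ℝ≥0∞) ^ d * μHE[d] (g '' t) := by
  rcases t.eq_empty_or_nonempty with rfl | ⟨x₀, hx₀⟩
  · simp
  have : Nonempty X := ⟨x₀⟩
  have hinv : ∀ x ∈ t, Function.invFunOn g t (g x) ∈ t ∧ g (Function.invFunOn g t (g x)) = g x :=
    fun x hx => ⟨Function.invFunOn_mem ⟨x, hx, rfl⟩, Function.invFunOn_eq ⟨x, hx, rfl⟩⟩
  have himage : (fun z => f (Function.invFunOn g t z)) '' (g '' t) = f '' t := by
    rw [image_image]
    refine image_congr fun x hx => ?_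
    obtain ⟨h1, h2⟩ := hinv x hx
    have := h _ h1 x hx
    rw [h2, edist_self, mul_zero] at this
    exact edist_le_zero.1 this
  have hlip : LipschitzOnWith C (fun z => f (Function.invFunOn g t z)) (g '' t) := by
    rintro _ ⟨x, hx, rfl⟩ _ ⟨y, hy, rfl⟩
    obtain ⟨h1, h2⟩ := hinv x hx
    obtain ⟨h3, h4⟩ := hinv y hy
    simpa only [h2, h4] using h _ h1 _ h3
  have key := hlip.hausdorffMeasure_image_le (d := d) (by positivity)
  rw [himage, ENNReal.rpow_natCast] at key
  simp only [Measure.euclideanHausdorffMeasure_def, Measure.smul_apply, ENNReal.smul_def,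
    smul_eq_mul]
  rw [mul_left_comm]
  gcongr

variable {U V : Type*} [NormedAddCommGroup U] [InnerProductSpace ℝ U] [FiniteDimensional ℝ U]
  [NormedAddCommGroup V] [InnerProductSpace ℝ V]

/-- Near a point with injective strict derivative, `f` and its nearby derivatives are comparable,
up to a factor `C > 1`, with the derivative at the point. -/
theorem exists_nhds_comparable {f : U → V} {f' : U → U →L[ℝ] V} {s : Set U} {x : U}
    (hf : HasStrictFDerivAt f (f' x) x) (hc : ContinuousWithinAt f' s x)
    (hinj : Function.Injective (f' x)) {C : ℝ} (hC : 1 < C) :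
    ∃ N : Set U, IsOpen N ∧ x ∈ N ∧
      (∀ y ∈ N, ∀ z ∈ N, ‖f y - f z‖ ≤ C * ‖f' x (y - z)‖ ∧ ‖f' x (y - z)‖ ≤ C * ‖f y - f z‖) ∧
      (∀ y ∈ N ∩ s, ∀ v, ‖f' y v‖ ≤ C * ‖f' x v‖ ∧ ‖f' x v‖ ≤ C * ‖f' y v‖) := by
  obtain ⟨K, Kpos, hK⟩ := (f' x).toLinearMap.exists_antilipschitzWith
    (LinearMap.ker_eq_bot.2 hinj)
  have hK' : ∀ v, ‖v‖ ≤ K * ‖f' x v‖ := fun v => by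
    have := hK.le_mul_dist v 0
    simpa [dist_eq_norm] using this
  have hKr : (0 : ℝ) < K := Kpos
  -- With this ε, an error ε‖v‖ is at most (1 - C⁻¹)‖f' x v‖. The lower comparison then has constant
  -- exactly C, and the upper one 2 - C⁻¹ ≤ C.
  set ε : ℝ := (1 - C⁻¹) / K with hε
  have hC0 : 0 < C := by linarith
  have hCinv : C⁻¹ < 1 := inv_lt_one_of_one_lt₀ hC
  have εpos : 0 < ε := div_pos (by linarith) hKr
  have hεK : ε * K = 1 - C⁻¹ := by rw [hε]; field_simp
  have hCC : 1 - C⁻¹ ≤ C - 1 := by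
    have : 1 - C⁻¹ = (C - 1) * C⁻¹ := by field_simp
    rw [this]; nlinarith
  have key : ∀ (w : V) (v : U), ‖w - f' x v‖ ≤ ε * ‖v‖ →
      ‖w‖ ≤ C * ‖f' x v‖ ∧ ‖f' x v‖ ≤ C * ‖w‖ := by
    intro w v hw
    have h1 : ‖w - f' x v‖ ≤ (1 - C⁻¹) * ‖f' x v‖ := by
      calc _ ≤ ε * ‖v‖ := hw
        _ ≤ ε * (K * ‖f' x v‖) := by gcongr; exact hK' v
        _ = _ := by rw [← mul_assoc, hεK]
    have h2 : ‖w‖ ≤ ‖w - f' x v‖ + ‖f' x v‖ := by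
      simpa using norm_add_le (w - f' x v) (f' x v)
    have h3 : ‖f' x v‖ ≤ ‖w - f' x v‖ + ‖w‖ := by
      have := norm_sub_le w (w - f' x v)
      simp only [sub_sub_cancel] at this
      linarith
    refine ⟨by nlinarith [norm_nonneg (f' x v)], ?_⟩
    have h4 : C⁻¹ * ‖f' x v‖ ≤ ‖w‖ := by nlinarith
    rwa [inv_mul_le_iff₀ hC0] at h4
  have hev1 := hf.isLittleO.def εpos
  rw [nhds_prod_eq] at hev1
  obtain ⟨t, ht, hts⟩ := mem_prod_self_iff.1 hev1
  have hev2 : ∀ᶠ y in 𝓝[s] x, ‖f' y - f' x‖ < ε := by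
    have := hc.tendsto.sub_const (f' x) |>.norm
    simp only [sub_self, norm_zero] at this
    exact this.eventually_lt_const εpos
  rw [eventually_nhdsWithin_iff] at hev2
  obtain ⟨N, hN, hNo, hxN⟩ := mem_nhds_iff.1 (Filter.inter_mem ht hev2)
  refine ⟨N, hNo, hxN, fun y hy z hz => ?_, fun y hy v => ?_⟩
  · exact key _ _ (hts (mk_mem_prod (hN hy).1 (hN hz).1))
  · refine key _ _ ?_
    have : ‖f' y - f' x‖ < ε := (hN hy.1).2 hy.2
    calc _ = ‖(f' y - f' x) v‖ := by simp
      _ ≤ ‖f' y - f' x‖ * ‖v‖ := ContinuousLinearMap.le_opNorm _ _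
      _ ≤ _ := by gcongr

variable [MeasurableSpace U] [BorelSpace U] [MeasurableSpace V] [BorelSpace V]

/-- Compare the images of the unit ball, whose volume is positive and finite and so cancels. -/
theorem LinearMap.normDet_le_of_norm_le {A B : U →ₗ[ℝ] V} {C : ℝ≥0}
    (h : ∀ x, ‖A x‖ ≤ C * ‖B x‖) : A.normDet ≤ C ^ finrank ℝ U * B.normDet := by
  have h1 : μHE[finrank ℝ U] (A '' Metric.ball 0 1) ≤
      (C : ℝ≥0∞) ^ finrank ℝ U * μHE[finrank ℝ U] (B '' Metric.ball 0 1) := by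
    refine euclideanHausdorffMeasure_image_le_of_edist_le _ fun x _ y _ => ?_
    rw [edist_eq_enorm_sub, edist_eq_enorm_sub, ← map_sub, ← map_sub]
    have := h (x - y)
    rw [enorm_eq_nnnorm, enorm_eq_nnnorm]
    exact_mod_cast this
  rw [LinearMap.euclideanHausdorffMeasure_image_eq_normDet_mul_volume,
    LinearMap.euclideanHausdorffMeasure_image_eq_normDet_mul_volume, ← mul_assoc] at h1
  rw [ENNReal.mul_le_mul_iff_left (Metric.measure_ball_pos _ _ one_pos).ne'
    measure_ball_lt_top.ne] at h1
  have h2 : (C : ℝ≥0∞) ^ finrank ℝ U = ENNReal.ofReal (C ^ finrank ℝ U) := by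
    rw [ENNReal.ofReal_pow C.coe_nonneg, ENNReal.ofReal_coe_nnreal]
  rw [h2, ← ENNReal.ofReal_mul (by positivity), ENNReal.ofReal_le_ofReal_iff
    (mul_nonneg (by positivity) B.normDet_nonneg)] at h1
  exact h1

/-- On a small piece, replacing f by a fixed derivative costs C^d, and freezing the derivative in
the integrand costs another C^d. The total does not depend on the piece, so it survives summation
over a countable partition. -/
theorem euclideanHausdorffMeasure_image_comparable {f : U → V} {f' : U → U →L[ℝ] V} {s : Set U}
    (hs : MeasurableSet s) (hf : ∀ x ∈ s, HasStrictFDerivAt f (f' x) x) (hc : ContinuousOn f' s)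
    (hinj' : ∀ x ∈ s, Function.Injective (f' x)) (hinj : InjOn f s) {C : ℝ≥0} (hC : 1 < C) :
    μHE[finrank ℝ U] (f '' s) ≤ ((C : ℝ≥0∞) ^ finrank ℝ U) ^ 2 *
        ∫⁻ x in s, ENNReal.ofReal (f' x).toLinearMap.normDet ∧
    ∫⁻ x in s, ENNReal.ofReal (f' x).toLinearMap.normDet ≤
      ((C : ℝ≥0∞) ^ finrank ℝ U) ^ 2 * μHE[finrank ℝ U] (f '' s) := by
  classical
  set c : ℝ≥0∞ := (C : ℝ≥0∞) ^ finrank ℝ U with hcdef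
  have hfc : ContinuousOn f s := fun x hx => (hf x hx).continuousAt.continuousWithinAt
  choose! N hNo hxN hN1 hN2 using fun x (hx : x ∈ s) =>
    exists_nhds_comparable (hf x hx) (hc x hx) (hinj' x hx) (C := C) (by exact_mod_cast hC)
  have hloc : ∀ x ∈ s, ∀ t ⊆ s ∩ N x, MeasurableSet t →
      μHE[finrank ℝ U] (f '' t) ≤ c ^ 2 * ∫⁻ x in t, ENNReal.ofReal (f' x).toLinearMap.normDet ∧
      ∫⁻ x in t, ENNReal.ofReal (f' x).toLinearMap.normDet ≤
        c ^ 2 * μHE[finrank ℝ U] (f '' t) := by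
    intro x hx t hts htm
    have hnn : ∀ a b : V, ‖a‖ ≤ C * ‖b‖ → ‖a‖ₑ ≤ C * ‖b‖ₑ := fun a b h => by
      rw [enorm_eq_nnnorm, enorm_eq_nnnorm]; exact_mod_cast h
    have h1 : μHE[finrank ℝ U] (f '' t) ≤ c * μHE[finrank ℝ U] (f' x '' t) :=
      euclideanHausdorffMeasure_image_le_of_edist_le _ fun y hy z hz => by
        rw [edist_eq_enorm_sub, edist_eq_enorm_sub, ← map_sub]
        exact hnn _ _ (hN1 x hx y (hts hy).2 z (hts hz).2).1
    have h2 : μHE[finrank ℝ U] (f' x '' t) ≤ c * μHE[finrank ℝ U] (f '' t) :=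
      euclideanHausdorffMeasure_image_le_of_edist_le _ fun y hy z hz => by
        rw [edist_eq_enorm_sub, edist_eq_enorm_sub, ← map_sub]
        exact hnn _ _ (hN1 x hx y (hts hy).2 z (hts hz).2).2
    have h3 : μHE[finrank ℝ U] (f' x '' t) =
        ∫⁻ _ in t, ENNReal.ofReal (f' x).toLinearMap.normDet := by
      rw [setLIntegral_const]
      exact (f' x).toLinearMap.euclideanHausdorffMeasure_image_eq_normDet_mul_volume t
    have hcr : c = ENNReal.ofReal (C ^ finrank ℝ U) := by
      rw [ENNReal.ofReal_pow C.coe_nonneg, ENNReal.ofReal_coe_nnreal]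
    have h4 : ∫⁻ _ in t, ENNReal.ofReal (f' x).toLinearMap.normDet ≤
        c * ∫⁻ y in t, ENNReal.ofReal (f' y).toLinearMap.normDet := by
      rw [← lintegral_const_mul' _ _ (by simp [hcdef])]
      refine setLIntegral_mono' htm fun y hy => ?_
      rw [hcr, ← ENNReal.ofReal_mul (by positivity)]
      exact ENNReal.ofReal_le_ofReal (LinearMap.normDet_le_of_norm_le fun v =>
        (hN2 x hx y ⟨(hts hy).2, (hts hy).1⟩ v).2)
    have h5 : ∫⁻ y in t, ENNReal.ofReal (f' y).toLinearMap.normDet ≤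
        c * ∫⁻ _ in t, ENNReal.ofReal (f' x).toLinearMap.normDet := by
      rw [← lintegral_const_mul' _ _ (by simp [hcdef])]
      refine setLIntegral_mono' htm fun y hy => ?_
      rw [hcr, ← ENNReal.ofReal_mul (by positivity)]
      exact ENNReal.ofReal_le_ofReal (LinearMap.normDet_le_of_norm_le fun v =>
        (hN2 x hx y ⟨(hts hy).2, (hts hy).1⟩ v).1)
    constructor
    · calc _ ≤ c * μHE[finrank ℝ U] (f' x '' t) := h1
        _ ≤ c * (c * ∫⁻ y in t, ENNReal.ofReal (f' y).toLinearMap.normDet) := by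
          rw [h3]; gcongr
        _ = _ := by rw [← mul_assoc, sq]
    · calc _ ≤ c * μHE[finrank ℝ U] (f' x '' t) := by rw [h3]; exact h5
        _ ≤ c * (c * μHE[finrank ℝ U] (f '' t)) := by gcongr
        _ = _ := by rw [← mul_assoc, sq]
  rcases s.eq_empty_or_nonempty with rfl | hne
  · simp
  obtain ⟨T, hTs, hTc, hTcov⟩ := TopologicalSpace.countable_cover_nhdsWithin (f := N) (s := s)
    fun x hx => mem_nhdsWithin_of_mem_nhds ((hNo x hx).mem_nhds (hxN x hx))
  have hTne : T.Nonempty := by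
    by_contra h
    rw [not_nonempty_iff_eq_empty] at h
    obtain ⟨x, hx⟩ := hne
    simpa [h] using hTcov hx
  obtain ⟨e, he⟩ := hTc.exists_eq_range hTne
  have heT : ∀ n, e n ∈ s := fun n => hTs (he ▸ mem_range_self n)
  set P : ℕ → Set U := fun n => s ∩ disjointed (fun n => N (e n)) n with hP
  have hPm : ∀ n, MeasurableSet (P n) := fun n =>
    hs.inter (MeasurableSet.disjointed (fun n => (hNo _ (heT n)).measurableSet) n)
  have hPd : Pairwise (Function.onFun Disjoint P) := fun i j hij =>
    ((disjoint_disjointed (fun n => N (e n))) hij).mono inter_subset_right inter_subset_right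
  have hPs : ∀ n, P n ⊆ s ∩ N (e n) := fun n =>
    inter_subset_inter_right _ (disjointed_subset _ _)
  have hPu : s = ⋃ n, P n := by
    rw [hP, ← inter_iUnion, iUnion_disjointed]
    refine (inter_eq_left.2 fun x hx => ?_).symm
    have := hTcov hx
    rw [he] at this
    simpa using this
  have hsum1 : ∫⁻ x in s, ENNReal.ofReal (f' x).toLinearMap.normDet =
      ∑' n, ∫⁻ x in P n, ENNReal.ofReal (f' x).toLinearMap.normDet := by
    rw [hPu, lintegral_iUnion hPm hPd]
  have hsum2 : μHE[finrank ℝ U] (f '' s) = ∑' n, μHE[finrank ℝ U] (f '' P n) := by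
    have hPs' : ∀ n, P n ⊆ s := fun n => (hPs n).trans inter_subset_left
    conv_lhs => rw [hPu, image_iUnion]
    refine measure_iUnion (fun i j hij => ?_) fun n => ?_
    · exact (hPd hij).image hinj (hPs' i) (hPs' j)
    -- A continuous injective image of a Borel set is Borel, which countable additivity requires
    -- here.
    · exact (hPm n).image_of_continuousOn_injOn (hfc.mono (hPs' n)) (hinj.mono (hPs' n))
  rw [hsum1, hsum2, ← ENNReal.tsum_mul_left, ← ENNReal.tsum_mul_left]
  exact ⟨ENNReal.tsum_le_tsum fun n => (hloc _ (heT n) _ (hPs n) (hPm n)).1,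
    ENNReal.tsum_le_tsum fun n => (hloc _ (heT n) _ (hPs n) (hPm n)).2⟩

/-- Area formula for an injective `C¹` immersion. -/
theorem euclideanHausdorffMeasure_image_eq_lintegral_normDet {f : U → V} {f' : U → U →L[ℝ] V}
    {s : Set U} (hs : MeasurableSet s) (hf : ∀ x ∈ s, HasStrictFDerivAt f (f' x) x)
    (hc : ContinuousOn f' s) (hinj' : ∀ x ∈ s, Function.Injective (f' x)) (hinj : InjOn f s) :
    μHE[finrank ℝ U] (f '' s) = ∫⁻ x in s, ENNReal.ofReal (f' x).toLinearMap.normDet := by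
  have hlim : ∀ a : ℝ≥0∞, Tendsto (fun C : ℝ≥0 => ((C : ℝ≥0∞) ^ finrank ℝ U) ^ 2 * a) (𝓝[>] 1)
      (𝓝 a) := by
    intro a
    have h1 : Tendsto (fun C : ℝ≥0 => ((C : ℝ≥0∞) ^ finrank ℝ U) ^ 2) (𝓝[>] 1) (𝓝 1) := by
      have : Continuous fun C : ℝ≥0 => ((C : ℝ≥0∞) ^ finrank ℝ U) ^ 2 := by
        have : Continuous fun C : ℝ≥0 => (((C ^ finrank ℝ U) ^ 2 : ℝ≥0) : ℝ≥0∞) := by fun_prop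
        simpa using this
      have := (this.tendsto 1).mono_left (nhdsWithin_le_nhds (s := Ioi 1))
      simpa using this
    simpa using ENNReal.Tendsto.mul_const h1 (b := a) (Or.inl one_ne_zero)
  refine le_antisymm (ge_of_tendsto (hlim _) ?_) (ge_of_tendsto (hlim _) ?_)
  · filter_upwards [self_mem_nhdsWithin] with C hC using
      (euclideanHausdorffMeasure_image_comparable hs hf hc hinj' hinj hC).1
  · filter_upwards [self_mem_nhdsWithin] with C hC using
      (euclideanHausdorffMeasure_image_comparable hs hf hc hinj' hinj hC).2

end AreaFormula

/-! ### Common tangent planes of the two disks and their contact points. -/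

/-- The point where the tangent plane with conormal `supportConormal α` touches the horizontal
circle. -/
noncomputable def horizontalPoint (α : ℝ) : EuclideanSpace ℝ (Fin 3) :=
  !₂[2 * √2 * cos α / (1 + 2 * cos α ^ 2), -2 / (1 + 2 * cos α ^ 2), 0]

/-- The point where the tangent plane with conormal `supportConormal α` touches the vertical
circle. -/
noncomputable def verticalPoint (α : ℝ) : EuclideanSpace ℝ (Fin 3) :=
  !₂[0, 2 / (1 + 2 * sin α ^ 2), 2 * √2 * sin α / (1 + 2 * sin α ^ 2)]

/-- The ruled parametrization of the boundary of the hull. -/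
noncomputable def hullBoundary (α t : ℝ) : EuclideanSpace ℝ (Fin 3) :=
  (1 - t) • horizontalPoint α + t • verticalPoint α

/-- The linear functional whose value `1` describes a common tangent plane of the two disks. -/
noncomputable def supportFunctional (α : ℝ) (p : EuclideanSpace ℝ (Fin 3)) : ℝ :=
  √2 * cos α * p 0 + (cos α ^ 2 - sin α ^ 2) / 2 * p 1 + √2 * sin α * p 2

theorem hullBoundary_apply_zero (α t : ℝ) :
    hullBoundary α t 0 = (1 - t) * (2 * √2 * cos α / (1 + 2 * cos α ^ 2)) := by
  simp [hullBoundary, horizontalPoint, verticalPoint]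

theorem hullBoundary_apply_one (α t : ℝ) : hullBoundary α t 1 =
    (1 - t) * (-2 / (1 + 2 * cos α ^ 2)) + t * (2 / (1 + 2 * sin α ^ 2)) := by
  simp [hullBoundary, horizontalPoint, verticalPoint]

theorem hullBoundary_apply_two (α t : ℝ) :
    hullBoundary α t 2 = t * (2 * √2 * sin α / (1 + 2 * sin α ^ 2)) := by
  simp [hullBoundary, horizontalPoint, verticalPoint]

theorem horizontalPoint_mem (α : ℝ) : horizontalPoint α ∈ horizontalDisk := by
  have h : (0 : ℝ) < 1 + 2 * cos α ^ 2 := by positivity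
  refine ⟨le_of_eq ?_, by simp [horizontalPoint]⟩
  have h2 : √2 ^ 2 = 2 := Real.sq_sqrt (by norm_num)
  simp only [horizontalPoint, PiLp.toLp_apply, Matrix.cons_val_zero, Matrix.cons_val_one]
  field_simp
  linear_combination 4 * cos α ^ 2 * h2

theorem verticalPoint_mem (α : ℝ) : verticalPoint α ∈ verticalDisk := by
  have h : (0 : ℝ) < 1 + 2 * sin α ^ 2 := by positivity
  refine ⟨le_of_eq ?_, by simp [verticalPoint]⟩
  have h2 : √2 ^ 2 = 2 := Real.sq_sqrt (by norm_num)
  simp only [verticalPoint, PiLp.toLp_apply, Matrix.cons_val_one, Matrix.cons_val]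
  field_simp
  linear_combination 4 * sin α ^ 2 * h2

theorem supportFunctional_horizontalPoint (α : ℝ) :
    supportFunctional α (horizontalPoint α) = 1 := by
  have h : (0 : ℝ) < 1 + 2 * cos α ^ 2 := by positivity
  have h2 : √2 ^ 2 = 2 := Real.sq_sqrt (by norm_num)
  simp only [supportFunctional, horizontalPoint, PiLp.toLp_apply, Matrix.cons_val_one,
    Matrix.cons_val, Matrix.cons_val_zero]
  field_simp
  linear_combination 2 * cos α ^ 2 * h2 + sin_sq_add_cos_sq α

theorem supportFunctional_verticalPoint (α : ℝ) :
    supportFunctional α (verticalPoint α) = 1 := by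
  have h : (0 : ℝ) < 1 + 2 * sin α ^ 2 := by positivity
  have h2 : √2 ^ 2 = 2 := Real.sq_sqrt (by norm_num)
  simp only [supportFunctional, verticalPoint, PiLp.toLp_apply, Matrix.cons_val_one,
    Matrix.cons_val, Matrix.cons_val_zero]
  field_simp
  linear_combination 2 * sin α ^ 2 * h2 + sin_sq_add_cos_sq α

theorem supportFunctional_combination (α s t : ℝ) (p q : EuclideanSpace ℝ (Fin 3)) :
    supportFunctional α (s • p + t • q) =
      s * supportFunctional α p + t * supportFunctional α q := by
  simp only [supportFunctional, PiLp.add_apply, PiLp.smul_apply, smul_eq_mul]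
  ring

theorem supportFunctional_hullBoundary (α t : ℝ) :
    supportFunctional α (hullBoundary α t) = 1 := by
  rw [hullBoundary, supportFunctional_combination, supportFunctional_horizontalPoint,
    supportFunctional_verticalPoint]
  ring

/-- If `n₀ x + n₁ y ≤ 1` is a tangent half-plane of the unit disk centred at `(0, -1)`, it contains
the disk, and the line meets the disk only at the point of tangency. -/
theorem tangent_line_disk {n₀ n₁ x y : ℝ} (hn : n₀ ^ 2 = 1 + 2 * n₁)
    (hxy : x ^ 2 + (y + 1) ^ 2 ≤ 1) : n₀ * x + n₁ * y ≤ 1 ∧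
      (n₀ * x + n₁ * y = 1 → x = n₀ / (1 + n₁) ∧ y = -1 / (1 + n₁)) := by
  have hpos : 0 < 1 + n₁ := by nlinarith [sq_nonneg n₀]
  constructor
  · have h : (n₀ * x + n₁ * (y + 1)) ^ 2 ≤ (1 + n₁) ^ 2 := by
      nlinarith [sq_nonneg (n₀ * (y + 1) - n₁ * x), sq_nonneg (1 + n₁)]
    have := abs_le_of_sq_le_sq' h hpos.le
    linarith [this.2]
  · intro h
    -- Equality case of Cauchy–Schwarz: (x, y + 1) must be the unit vector (n₀, n₁) / (1 + n₁).
    have hsum : ((1 + n₁) * x - n₀) ^ 2 + ((1 + n₁) * (y + 1) - n₁) ^ 2 ≤ 0 := by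
      nlinarith [sq_nonneg (1 + n₁)]
    have h1 : (1 + n₁) * x - n₀ = 0 := by
      have : ((1 + n₁) * x - n₀) ^ 2 ≤ 0 := by nlinarith [sq_nonneg ((1 + n₁) * (y + 1) - n₁)]
      exact pow_eq_zero_iff two_ne_zero |>.1 (le_antisymm this (sq_nonneg _))
    have h2 : (1 + n₁) * (y + 1) - n₁ = 0 := by
      have : ((1 + n₁) * (y + 1) - n₁) ^ 2 ≤ 0 := by nlinarith [sq_nonneg ((1 + n₁) * x - n₀)]
      exact pow_eq_zero_iff two_ne_zero |>.1 (le_antisymm this (sq_nonneg _))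
    constructor
    · rw [eq_div_iff hpos.ne']; linarith
    · rw [eq_div_iff hpos.ne']; linarith

theorem sq_sqrt_two_mul_cos (α : ℝ) :
    (√2 * cos α) ^ 2 = 1 + 2 * ((cos α ^ 2 - sin α ^ 2) / 2) := by
  have h2 : √2 ^ 2 = 2 := Real.sq_sqrt (by norm_num)
  linear_combination cos α ^ 2 * h2 + sin_sq_add_cos_sq α

theorem sq_sqrt_two_mul_sin (α : ℝ) :
    (√2 * sin α) ^ 2 = 1 + 2 * -((cos α ^ 2 - sin α ^ 2) / 2) := by
  have h2 : √2 ^ 2 = 2 := Real.sq_sqrt (by norm_num)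
  linear_combination sin α ^ 2 * h2 + sin_sq_add_cos_sq α

theorem one_add_half_cos (α : ℝ) :
    1 + (cos α ^ 2 - sin α ^ 2) / 2 = (1 + 2 * cos α ^ 2) / 2 := by
  linear_combination -(1 / 2) * sin_sq_add_cos_sq α

theorem one_sub_half_cos (α : ℝ) :
    1 + -((cos α ^ 2 - sin α ^ 2) / 2) = (1 + 2 * sin α ^ 2) / 2 := by
  linear_combination -(1 / 2) * sin_sq_add_cos_sq α

theorem supportFunctional_le_of_mem_horizontalDisk (α : ℝ) {p : EuclideanSpace ℝ (Fin 3)}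
    (hp : p ∈ horizontalDisk) : supportFunctional α p ≤ 1 := by
  have := (tangent_line_disk (sq_sqrt_two_mul_cos α) hp.1).1
  simp only [supportFunctional, hp.2]
  linarith

theorem supportFunctional_le_of_mem_verticalDisk (α : ℝ) {p : EuclideanSpace ℝ (Fin 3)}
    (hp : p ∈ verticalDisk) : supportFunctional α p ≤ 1 := by
  -- In the coordinates (z, -y) the vertical disk becomes the disk of `tangent_line_disk`, and n₁
  -- changes sign.
  have := (tangent_line_disk (x := p 2) (y := -p 1) (sq_sqrt_two_mul_sin α)
    (by nlinarith [hp.1])).1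
  simp only [supportFunctional, hp.2]
  linarith

theorem eq_horizontalPoint_of_supportFunctional_eq_one {α : ℝ} {p : EuclideanSpace ℝ (Fin 3)}
    (hp : p ∈ horizontalDisk) (h : supportFunctional α p = 1) : p = horizontalPoint α := by
  have hpos : (0 : ℝ) < 1 + 2 * cos α ^ 2 := by positivity
  simp only [supportFunctional, hp.2] at h
  have := (tangent_line_disk (sq_sqrt_two_mul_cos α) hp.1).2 (by linarith)
  rw [one_add_half_cos] at this
  ext i
  fin_cases i
  · simp only [horizontalPoint, Fin.zero_eta, PiLp.toLp_apply, Matrix.cons_val_zero]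
    rw [this.1]; field_simp
  · simp only [horizontalPoint, Fin.mk_one, PiLp.toLp_apply, Matrix.cons_val_one,
      Matrix.cons_val_zero]
    rw [this.2]; field_simp
  · simpa [horizontalPoint] using hp.2

theorem eq_verticalPoint_of_supportFunctional_eq_one {α : ℝ} {p : EuclideanSpace ℝ (Fin 3)}
    (hp : p ∈ verticalDisk) (h : supportFunctional α p = 1) : p = verticalPoint α := by
  have hpos : (0 : ℝ) < 1 + 2 * sin α ^ 2 := by positivity
  simp only [supportFunctional, hp.2] at h
  have := (tangent_line_disk (x := p 2) (y := -p 1) (sq_sqrt_two_mul_sin α)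
    (by nlinarith [hp.1])).2 (by linarith)
  rw [one_sub_half_cos] at this
  ext i
  fin_cases i
  · simpa [verticalPoint] using hp.2
  · simp only [verticalPoint, Fin.mk_one, PiLp.toLp_apply, Matrix.cons_val_one,
      Matrix.cons_val_zero]
    rw [← neg_neg (p 1), this.2]; field_simp
  · simp only [verticalPoint, Fin.reduceFinMk, PiLp.toLp_apply, Matrix.cons_val]
    rw [this.1]; field_simp

/-! ### The hull and the description of its boundary by rulings. -/

theorem exists_angle {x y : ℝ} (h : x ^ 2 + y ^ 2 = 2) :
    ∃ α ∈ Ioc (-π) π, x = √2 * cos α ∧ y = √2 * sin α := by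
  have hn : ‖(⟨x, y⟩ : ℂ)‖ = √2 := by
    rw [Complex.norm_def, Complex.normSq_mk, ← h]; ring_nf
  refine ⟨Complex.arg ⟨x, y⟩, Complex.arg_mem_Ioc _, ?_, ?_⟩
  · rw [← hn, Complex.norm_mul_cos_arg]
  · rw [← hn, Complex.norm_mul_sin_arg]

theorem convex_horizontalDisk : Convex ℝ horizontalDisk := by
  rintro p ⟨hp, hp'⟩ q ⟨hq, hq'⟩ a b ha hb hab
  obtain rfl : b = 1 - a := by linarith
  refine ⟨?_, by simp [hp', hq']⟩
  simp only [PiLp.add_apply, PiLp.smul_apply, smul_eq_mul]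
  nlinarith [mul_nonneg ha hb, sq_nonneg (p 0 - q 0), sq_nonneg (p 1 - q 1),
    mul_nonneg (mul_nonneg ha hb) (add_nonneg (sq_nonneg (p 0 - q 0)) (sq_nonneg (p 1 - q 1))),
    mul_le_mul_of_nonneg_left hp ha, mul_le_mul_of_nonneg_left hq hb]

theorem convex_verticalDisk : Convex ℝ verticalDisk := by
  rintro p ⟨hp, hp'⟩ q ⟨hq, hq'⟩ a b ha hb hab
  obtain rfl : b = 1 - a := by linarith
  refine ⟨?_, by simp [hp', hq']⟩
  simp only [PiLp.add_apply, PiLp.smul_apply, smul_eq_mul]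
  nlinarith [mul_nonneg ha hb, sq_nonneg (p 2 - q 2), sq_nonneg (p 1 - q 1),
    mul_nonneg (mul_nonneg ha hb) (add_nonneg (sq_nonneg (p 2 - q 2)) (sq_nonneg (p 1 - q 1))),
    mul_le_mul_of_nonneg_left hp ha, mul_le_mul_of_nonneg_left hq hb]

theorem isCompact_of_isClosed_of_abs_le {s : Set (EuclideanSpace ℝ (Fin 3))} (hs : IsClosed s)
    {r : ℝ} (hr : ∀ p ∈ s, ∀ i, |p i| ≤ r) : IsCompact s := by
  refine Metric.isCompact_of_isClosed_isBounded hs ?_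
  refine (Metric.isBounded_closedBall (x := (0 : EuclideanSpace ℝ (Fin 3))) (r := √(3 * r ^ 2))).subset
    fun p hp => ?_
  rw [mem_closedBall_zero_iff, EuclideanSpace.norm_eq]
  refine Real.sqrt_le_sqrt ?_
  simp only [Fin.sum_univ_three, Real.norm_eq_abs]
  have : ∀ i, |p i| ^ 2 ≤ r ^ 2 := fun i => pow_le_pow_left₀ (abs_nonneg _) (hr p hp i) 2
  linarith [this 0, this 1, this 2]

theorem isCompact_horizontalDisk : IsCompact horizontalDisk := by
  refine isCompact_of_isClosed_of_abs_le (r := 2) ?_ fun p hp i => ?_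
  · have h1 : IsClosed {p : EuclideanSpace ℝ (Fin 3) | p 0 ^ 2 + (p 1 + 1) ^ 2 ≤ 1} :=
      isClosed_le (by fun_prop) (by fun_prop)
    have h2 : IsClosed {p : EuclideanSpace ℝ (Fin 3) | p 2 = 0} :=
      isClosed_eq (by fun_prop) (by fun_prop)
    exact h1.inter h2
  · obtain ⟨h1, h2⟩ := hp
    rw [abs_le]
    fin_cases i <;> simp <;> constructor <;> nlinarith [sq_nonneg (p 0), sq_nonneg (p 1 + 1)]

theorem isCompact_verticalDisk : IsCompact verticalDisk := by
  refine isCompact_of_isClosed_of_abs_le (r := 2) ?_ fun p hp i => ?_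
  · have h1 : IsClosed {p : EuclideanSpace ℝ (Fin 3) | (p 1 - 1) ^ 2 + p 2 ^ 2 ≤ 1} :=
      isClosed_le (by fun_prop) (by fun_prop)
    have h2 : IsClosed {p : EuclideanSpace ℝ (Fin 3) | p 0 = 0} :=
      isClosed_eq (by fun_prop) (by fun_prop)
    exact h1.inter h2
  · obtain ⟨h1, h2⟩ := hp
    rw [abs_le]
    fin_cases i <;> simp <;> constructor <;> nlinarith [sq_nonneg (p 2), sq_nonneg (p 1 - 1)]

/-- The hull of two nonempty convex sets is their join. This form gives compactness and writes each
point as a mixture of one point from each disk. -/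
theorem twoDiskHull_eq_image : twoDiskHull =
    (fun x : (EuclideanSpace ℝ (Fin 3) × EuclideanSpace ℝ (Fin 3)) × ℝ =>
      (1 - x.2) • x.1.1 + x.2 • x.1.2) '' ((horizontalDisk ×ˢ verticalDisk) ×ˢ Icc 0 1) := by
  rw [twoDiskHull, convex_horizontalDisk.convexHull_union convex_verticalDisk
    ⟨_, horizontalPoint_mem 0⟩ ⟨_, verticalPoint_mem 0⟩]
  ext p
  simp only [mem_convexJoin, segment_eq_image, mem_image, mem_prod, Prod.exists]
  constructor
  · rintro ⟨a, ha, b, hb, t, ht, rfl⟩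
    exact ⟨a, b, t, ⟨⟨ha, hb⟩, ht⟩, rfl⟩
  · rintro ⟨a, b, t, ⟨⟨ha, hb⟩, ht⟩, rfl⟩
    exact ⟨a, ha, b, hb, t, ht, rfl⟩

theorem isClosed_twoDiskHull : IsClosed twoDiskHull := by
  rw [twoDiskHull_eq_image]
  refine IsCompact.isClosed (IsCompact.image ?_ (by fun_prop))
  exact (isCompact_horizontalDisk.prod isCompact_verticalDisk).prod isCompact_Icc

theorem supportFunctional_le_of_mem_twoDiskHull (α : ℝ) {p : EuclideanSpace ℝ (Fin 3)}
    (hp : p ∈ twoDiskHull) : supportFunctional α p ≤ 1 := by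
  rw [twoDiskHull_eq_image] at hp
  obtain ⟨⟨⟨a, b⟩, t⟩, ⟨⟨ha, hb⟩, ht⟩, rfl⟩ := hp
  simp only at ha hb ht
  simp only [supportFunctional_combination]
  nlinarith [supportFunctional_le_of_mem_horizontalDisk α ha,
    supportFunctional_le_of_mem_verticalDisk α hb, ht.1, ht.2]

theorem hullBoundary_mem_frontier (α : ℝ) {t : ℝ} (ht : t ∈ Icc (0 : ℝ) 1) :
    hullBoundary α t ∈ frontier twoDiskHull := by
  rw [isClosed_twoDiskHull.frontier_eq]
  refine ⟨?_, fun hint => ?_⟩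
  · rw [twoDiskHull_eq_image]
    exact ⟨⟨⟨_, _⟩, t⟩, ⟨⟨horizontalPoint_mem α, verticalPoint_mem α⟩, ht⟩, rfl⟩
  -- An interior point could be dilated by 1 + ε inside the hull, raising the functional above 1.
  -- The null summand only matches the shape of `supportFunctional_combination`.
  · have hcont : Continuous fun ε : ℝ => (1 + ε) • hullBoundary α t + (0 : ℝ) • hullBoundary α t := by
      fun_prop
    have hev : ∀ᶠ ε : ℝ in nhds 0,
        (1 + ε) • hullBoundary α t + (0 : ℝ) • hullBoundary α t ∈ twoDiskHull := by
      refine hcont.tendsto 0 (mem_interior_iff_mem_nhds.1 ?_)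
      simpa using hint
    obtain ⟨ε, hε, hε0⟩ := (hev.filter_mono nhdsWithin_le_nhds |>.and
      (self_mem_nhdsWithin (a := (0 : ℝ)) (s := Ioi 0))).exists
    have := supportFunctional_le_of_mem_twoDiskHull α hε
    rw [supportFunctional_combination, supportFunctional_hullBoundary] at this
    have : (0 : ℝ) < ε := hε0
    linarith

theorem interior_twoDiskHull_nonempty : (interior twoDiskHull).Nonempty := by
  rw [twoDiskHull, interior_convexHull_nonempty_iff_affineSpan_eq_top]
  set s := horizontalDisk ∪ verticalDisk
  have h0 : (0 : EuclideanSpace ℝ (Fin 3)) ∈ s := Or.inl ⟨by simp, by simp⟩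
  rw [AffineSubspace.affineSpan_eq_top_iff_vectorSpan_eq_top_of_nonempty ℝ _ _ ⟨0, h0⟩, eq_top_iff,
    ← (EuclideanSpace.basisFun (Fin 3) ℝ).toBasis.span_eq, Submodule.span_le]
  have hmem : ∀ p ∈ s, p ∈ vectorSpan ℝ s := fun p hp => by
    simpa using vsub_mem_vectorSpan ℝ hp h0
  have h1 : EuclideanSpace.single (1 : Fin 3) (1 : ℝ) ∈ vectorSpan ℝ s :=
    hmem _ (Or.inr ⟨by simp, by simp⟩)
  have h2 : !₂[(1 : ℝ), -1, 0] ∈ vectorSpan ℝ s := hmem _ (Or.inl ⟨by simp, by simp⟩)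
  have h3 : !₂[(0 : ℝ), 1, 1] ∈ vectorSpan ℝ s := hmem _ (Or.inr ⟨by simp, by simp⟩)
  rintro _ ⟨i, rfl⟩
  fin_cases i
  · convert! add_mem h2 h1 using 1
    ext i; fin_cases i <;> simp
  · simpa using h1
  · convert! sub_mem h3 h1 using 1
    ext i; fin_cases i <;> simp

/-- At a boundary point the hull has a supporting half-space `n ⬝ q ≤ 1`. -/
theorem exists_supporting_conormal {p : EuclideanSpace ℝ (Fin 3)}
    (hp : p ∈ frontier twoDiskHull) : ∃ n : Fin 3 → ℝ,
      (∀ q ∈ twoDiskHull, n 0 * q 0 + n 1 * q 1 + n 2 * q 2 ≤ 1) ∧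
      n 0 * p 0 + n 1 * p 1 + n 2 * p 2 = 1 := by
  have hconv : Convex ℝ twoDiskHull := convex_convexHull ℝ _
  obtain ⟨f, hf⟩ := geometric_hahn_banach_open_point hconv.interior isOpen_interior hp.2
  obtain ⟨n, hn⟩ : ∃ n : Fin 3 → ℝ, ∀ q, f q = n 0 * q 0 + n 1 * q 1 + n 2 * q 2 := by
    refine ⟨fun i => f (EuclideanSpace.single i 1), fun q => ?_⟩
    conv_lhs => rw [← (EuclideanSpace.basisFun (Fin 3) ℝ).sum_repr q]
    simp [Fin.sum_univ_three, map_add, mul_comm]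
  have hle : ∀ q ∈ twoDiskHull, f q ≤ f p := by
    intro q hq
    have : q ∈ closure (interior twoDiskHull) := by
      rw [hconv.closure_interior_eq_closure_of_nonempty_interior interior_twoDiskHull_nonempty]
      exact subset_closure hq
    exact closure_minimal (fun a ha => (hf a ha).le)
      (isClosed_le f.continuous continuous_const) this
  have hA : ∀ q ∈ horizontalDisk, f q ≤ f p := fun q hq =>
    hle q (subset_convexHull ℝ _ (Or.inl hq))
  have hB : ∀ q ∈ verticalDisk, f q ≤ f p := fun q hq =>
    hle q (subset_convexHull ℝ _ (Or.inr hq))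
  -- Were f p ≤ 0, the six points below would force f = 0, against strictness on the interior.
  -- Positivity allows normalizing the value at p to 1.
  have hpos : 0 < f p := by
    by_contra! hneg
    have a1 := hA !₂[1, -1, 0] ⟨by simp, by simp⟩
    have a2 := hA !₂[-1, -1, 0] ⟨by simp, by simp⟩
    have a3 := hA !₂[0, -2, 0] ⟨by simp; norm_num, by simp⟩
    have b1 := hB !₂[0, 1, 1] ⟨by simp, by simp⟩
    have b2 := hB !₂[0, 1, -1] ⟨by simp, by simp⟩
    have b3 := hB !₂[0, 2, 0] ⟨by simp; norm_num, by simp⟩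
    rw [hn] at a1 a2 a3 b1 b2 b3
    simp at a1 a2 a3 b1 b2 b3
    have e1 : n 1 = 0 := by linarith
    have e0 : n 0 = 0 := by linarith
    have e2 : n 2 = 0 := by linarith
    obtain ⟨q, hq⟩ := interior_twoDiskHull_nonempty
    have := hf q hq
    rw [hn q, hn p, e0, e1, e2] at this
    simp at this
  refine ⟨fun i => n i / f p, fun q hq => ?_, ?_⟩
  · have := hle q hq
    rw [hn q] at this
    calc _ = (n 0 * q 0 + n 1 * q 1 + n 2 * q 2) / f p := by ring
      _ ≤ 1 := (div_le_one hpos).2 this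
  · calc _ = (n 0 * p 0 + n 1 * p 1 + n 2 * p 2) / f p := by ring
      _ = 1 := by rw [← hn p, div_self hpos.ne']

/-- The maximum of the functional on the disk is r - n₁ with r = |(n₀, n₁)|, attained at the centre
plus the unit normal; squaring r ≤ 1 + n₁ gives the claim. -/
theorem sq_le_of_forall_disk_le {n₀ n₁ : ℝ}
    (h : ∀ x y, x ^ 2 + (y + 1) ^ 2 ≤ 1 → n₀ * x + n₁ * y ≤ 1) : n₀ ^ 2 ≤ 1 + 2 * n₁ := by
  have hr2 : √(n₀ ^ 2 + n₁ ^ 2) ^ 2 = n₀ ^ 2 + n₁ ^ 2 := Real.sq_sqrt (by positivity)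
  have hr0 : 0 ≤ √(n₀ ^ 2 + n₁ ^ 2) := Real.sqrt_nonneg _
  set r := √(n₀ ^ 2 + n₁ ^ 2)
  have hr : r ≤ 1 + n₁ := by
    rcases hr0.eq_or_lt with h0 | hpos
    · have := h 0 (-1) (by norm_num)
      linarith
    · have := h (n₀ / r) (n₁ / r - 1) (by
        rw [sub_add_cancel, div_pow, div_pow, ← add_div, ← hr2, div_self (by positivity)])
      have e : n₀ * (n₀ / r) + n₁ * (n₁ / r - 1) = r - n₁ := by
        field_simp
        linarith
      linarith
  nlinarith

theorem sq_ge_of_disk_eq {n₀ n₁ x y : ℝ} (hxy : x ^ 2 + (y + 1) ^ 2 ≤ 1)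
    (h : n₀ * x + n₁ * y = 1) : 1 + 2 * n₁ ≤ n₀ ^ 2 := by
  nlinarith [sq_nonneg (n₀ * (y + 1) - n₁ * x), sq_nonneg n₀, sq_nonneg n₁,
    mul_nonneg (add_nonneg (sq_nonneg n₀) (sq_nonneg n₁)) (sub_nonneg.2 hxy)]

theorem frontier_twoDiskHull_subset {p : EuclideanSpace ℝ (Fin 3)}
    (hp : p ∈ frontier twoDiskHull) :
    ∃ α ∈ Ioc (-π) π, ∃ t ∈ Icc (0 : ℝ) 1, p = hullBoundary α t := by
  obtain ⟨n, hle, heq⟩ := exists_supporting_conormal hp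
  have hpK : p ∈ twoDiskHull := isClosed_twoDiskHull.frontier_subset hp
  rw [twoDiskHull_eq_image] at hpK
  obtain ⟨⟨⟨a, b⟩, t⟩, ⟨⟨ha, hb⟩, ht⟩, rfl⟩ := hpK
  simp only at ha hb ht heq ⊢
  have hla : n 0 * a 0 + n 1 * a 1 ≤ 1 := by
    have := hle a (subset_convexHull ℝ _ (Or.inl ha))
    rw [ha.2] at this; linarith
  have hlb : n 2 * b 2 + -n 1 * -b 1 ≤ 1 := by
    have := hle b (subset_convexHull ℝ _ (Or.inr hb))
    rw [hb.2] at this; linarith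
  have hb1 : b 2 ^ 2 + (-b 1 + 1) ^ 2 ≤ 1 := by nlinarith [hb.1]
  have hsum : (1 - t) * (n 0 * a 0 + n 1 * a 1) + t * (n 2 * b 2 + -n 1 * -b 1) = 1 := by
    simp only [PiLp.add_apply, PiLp.smul_apply, smul_eq_mul, ha.2, hb.2] at heq
    linarith
  have hn0 : n 0 ^ 2 ≤ 1 + 2 * n 1 := sq_le_of_forall_disk_le fun x y hxy => by
    simpa using hle !₂[x, y, 0] (subset_convexHull ℝ _ (Or.inl ⟨by simpa using hxy, by simp⟩))
  have hn2 : n 2 ^ 2 ≤ 1 + 2 * -n 1 := sq_le_of_forall_disk_le fun x y hxy => by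
    have := hle !₂[0, -y, x] (subset_convexHull ℝ _ (Or.inr ⟨by simp; nlinarith, by simp⟩))
    simp at this
    linarith
  -- A disk of positive weight must be touched by the plane, which makes its inequality an equality.
  -- If t = 1 only the vertical disk is touched; as x = 0 there, n₀ may be replaced by √(1 + 2n₁),
  -- tilting the plane until it touches the other disk too. The case t = 0 is symmetric.
  obtain ⟨k, l, hk, hl, hka, hlb⟩ : ∃ k l : ℝ, k ^ 2 = 1 + 2 * n 1 ∧ l ^ 2 = 1 + 2 * -n 1 ∧
      (t = 1 ∨ k * a 0 + n 1 * a 1 = 1) ∧ (t = 0 ∨ l * b 2 + -n 1 * -b 1 = 1) := by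
    rcases eq_or_ne t 1 with rfl | h1
    · have h := sq_ge_of_disk_eq hb1 (show n 2 * b 2 + -n 1 * -b 1 = 1 by linarith)
      exact ⟨√(1 + 2 * n 1), n 2, Real.sq_sqrt (by nlinarith [sq_nonneg (n 0)]),
        le_antisymm hn2 h, Or.inl rfl, Or.inr (by linarith)⟩
    have ht1 : 0 < 1 - t := by
      have := lt_of_le_of_ne ht.2 h1
      linarith
    rcases eq_or_ne t 0 with rfl | h0
    · have h := sq_ge_of_disk_eq ha.1 (show n 0 * a 0 + n 1 * a 1 = 1 by linarith)
      exact ⟨n 0, √(1 + 2 * -n 1), le_antisymm hn0 h,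
        Real.sq_sqrt (by nlinarith [sq_nonneg (n 2)]), Or.inr (by linarith), Or.inl rfl⟩
    have ht0 : 0 < t := lt_of_le_of_ne ht.1 h0.symm
    have ea : n 0 * a 0 + n 1 * a 1 = 1 := le_antisymm hla (by nlinarith)
    have eb : n 2 * b 2 + -n 1 * -b 1 = 1 := le_antisymm hlb (by nlinarith)
    exact ⟨n 0, n 2, le_antisymm hn0 (sq_ge_of_disk_eq ha.1 ea),
      le_antisymm hn2 (sq_ge_of_disk_eq hb1 eb), Or.inr ea, Or.inr eb⟩
  obtain ⟨α, hα, rfl, rfl⟩ := exists_angle (show k ^ 2 + l ^ 2 = 2 by linarith)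
  have hn1 : n 1 = (cos α ^ 2 - sin α ^ 2) / 2 := by linarith [sq_sqrt_two_mul_cos α]
  refine ⟨α, hα, t, ht, ?_⟩
  rw [hullBoundary]
  congr 1
  · rcases hka with rfl | h
    · simp
    · rw [eq_horizontalPoint_of_supportFunctional_eq_one ha (α := α)]
      rw [supportFunctional, ha.2, ← hn1]
      linarith
  · rcases hlb with rfl | h
    · simp
    · rw [eq_verticalPoint_of_supportFunctional_eq_one hb (α := α)]
      rw [supportFunctional, hb.2, ← hn1]
      linarith

/-- With both weights positive, a mixture of two values at most 1 equals 1 only if both do, so a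
point of an open ruling determines both contact points. At t = 0 injectivity fails, as
`horizontalPoint` is even in the angle. -/
theorem hullBoundary_injOn :
    InjOn (fun x : ℝ × ℝ => hullBoundary x.1 x.2) (Ioc (-π) π ×ˢ Ioo 0 1) := by
  rintro ⟨α, t⟩ ⟨hα, ht⟩ ⟨β, u⟩ ⟨hβ, hu⟩ h
  simp only at hα ht hβ hu h
  have h1 := supportFunctional_hullBoundary α t
  rw [h, hullBoundary, supportFunctional_combination] at h1
  have la := supportFunctional_le_of_mem_horizontalDisk α (horizontalPoint_mem β)
  have lb := supportFunctional_le_of_mem_verticalDisk α (verticalPoint_mem β)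
  have ea := eq_horizontalPoint_of_supportFunctional_eq_one (horizontalPoint_mem β)
    (le_antisymm la (by nlinarith [hu.1, hu.2]))
  have eb := eq_verticalPoint_of_supportFunctional_eq_one (verticalPoint_mem β)
    (le_antisymm lb (by nlinarith [hu.1, hu.2]))
  have pc : ∀ γ : ℝ, (0 : ℝ) < 1 + 2 * cos γ ^ 2 := fun γ => by positivity
  have ps : ∀ γ : ℝ, (0 : ℝ) < 1 + 2 * sin γ ^ 2 := fun γ => by positivity
  have hs2 : (0 : ℝ) < √2 := by positivity
  have ec : cos β = cos α := by
    have e1 := congr($ea 1)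
    have e0 := congr($ea 0)
    simp only [horizontalPoint, PiLp.toLp_apply, Matrix.cons_val_one, Matrix.cons_val_zero] at e0 e1
    rw [div_eq_div_iff (pc β).ne' (pc α).ne'] at e1
    have : 1 + 2 * cos β ^ 2 = 1 + 2 * cos α ^ 2 := by linarith
    rw [this, div_left_inj' (pc α).ne'] at e0
    exact mul_left_cancel₀ (by positivity) e0
  have es : sin β = sin α := by
    have e1 := congr($eb 1)
    have e0 := congr($eb 2)
    simp only [verticalPoint, PiLp.toLp_apply, Matrix.cons_val_one, Matrix.cons_val_zero,
      Matrix.cons_val] at e0 e1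
    rw [div_eq_div_iff (ps β).ne' (ps α).ne'] at e1
    have : 1 + 2 * sin β ^ 2 = 1 + 2 * sin α ^ 2 := by linarith
    rw [this, div_left_inj' (ps α).ne'] at e0
    exact mul_left_cancel₀ (by positivity) e0
  have hαβ : β = α := by
    have hb : Complex.arg (Complex.cos β + Complex.sin β * Complex.I) = β :=
      Complex.arg_cos_add_sin_mul_I hβ
    have ha : Complex.arg (Complex.cos α + Complex.sin α * Complex.I) = α :=
      Complex.arg_cos_add_sin_mul_I hα
    rw [← ha, ← hb, ← Complex.ofReal_cos, ← Complex.ofReal_sin, ec, es, Complex.ofReal_cos,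
      Complex.ofReal_sin]
  subst hαβ
  -- Along a ruling the y-coordinate is strictly increasing in t.
  have h2 := congr($h 1)
  rw [hullBoundary_apply_one, hullBoundary_apply_one] at h2
  have q1 : 0 < 2 / (1 + 2 * cos β ^ 2) := div_pos two_pos (pc β)
  have q2 : 0 < 2 / (1 + 2 * sin β ^ 2) := div_pos two_pos (ps β)
  rw [neg_div] at h2
  have : (t - u) * (2 / (1 + 2 * cos β ^ 2) + 2 / (1 + 2 * sin β ^ 2)) = 0 := by linarith
  have : t = u := by
    rcases mul_eq_zero.1 this with h | h
    · linarith
    · linarith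
  rw [this]

/-! ### Area density of the ruled parametrization. -/

/-- The velocity of `hullBoundary α t` in the variable `α`. -/
noncomputable def hullBoundaryDeriv (α t : ℝ) : EuclideanSpace ℝ (Fin 3) :=
  !₂[(1 - t) * (2 * √2 * (sin α * (2 * cos α ^ 2 - 1)) / (1 + 2 * cos α ^ 2) ^ 2),
    -8 * (cos α * sin α) *
      ((1 - t) / (1 + 2 * cos α ^ 2) ^ 2 + t / (1 + 2 * sin α ^ 2) ^ 2),
    t * (2 * √2 * (cos α * (1 - 2 * sin α ^ 2)) / (1 + 2 * sin α ^ 2) ^ 2)]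

/-- The factor of the area density which is affine along the rulings. -/
noncomputable def rulingDensity (α t : ℝ) : ℝ :=
  (1 - t) * (16 * sin α ^ 2 / ((1 + 2 * cos α ^ 2) ^ 2 * (1 + 2 * sin α ^ 2))) +
    t * (16 * cos α ^ 2 / ((1 + 2 * sin α ^ 2) ^ 2 * (1 + 2 * cos α ^ 2)))

/-- The area density of `hullBoundary`. -/
noncomputable def areaDensity (α t : ℝ) : ℝ :=
  √(2 + (cos α ^ 2 - sin α ^ 2) ^ 2 / 4) * rulingDensity α t

theorem hasDerivAt_euclidean {n : ℕ} {f : ℝ → EuclideanSpace ℝ (Fin n)}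
    {f' : EuclideanSpace ℝ (Fin n)} {x : ℝ} (h : ∀ i, HasDerivAt (fun x => f x i) (f' i) x) :
    HasDerivAt f f' x :=
  (PiLp.continuousLinearEquiv 2 ℝ (fun _ : Fin n => ℝ)).symm.hasFDerivAt.comp_hasDerivAt x
    (hasDerivAt_pi.2 h)

theorem hasDerivAt_hullBoundary_angle (α t : ℝ) :
    HasDerivAt (fun α => hullBoundary α t) (hullBoundaryDeriv α t) α := by
  have pc : (1 + 2 * cos α ^ 2 : ℝ) ≠ 0 := by positivity
  have ps : (1 + 2 * sin α ^ 2 : ℝ) ≠ 0 := by positivity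
  have hDc : HasDerivAt (fun α => 1 + 2 * cos α ^ 2) (-4 * cos α * sin α) α := by
    refine (((hasDerivAt_cos α).fun_pow 2).const_mul 2 |>.const_add 1).congr_deriv ?_
    ring
  have hDs : HasDerivAt (fun α => 1 + 2 * sin α ^ 2) (4 * cos α * sin α) α := by
    refine (((hasDerivAt_sin α).fun_pow 2).const_mul 2 |>.const_add 1).congr_deriv ?_
    ring
  refine hasDerivAt_euclidean fun i => ?_
  fin_cases i
  · simp only [Fin.zero_eta, hullBoundary_apply_zero]
    refine ((((hasDerivAt_cos α).const_mul (2 * √2)).div hDc pc).const_mul (1 - t)).congr_deriv ?_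
    simp only [hullBoundaryDeriv, PiLp.toLp_apply, Matrix.cons_val_zero]
    ring
  · simp only [Fin.mk_one, hullBoundary_apply_one]
    refine ((((hasDerivAt_const α (-2 : ℝ)).div hDc pc).const_mul (1 - t)).add
      (((hasDerivAt_const α (2 : ℝ)).div hDs ps).const_mul t)).congr_deriv ?_
    simp only [hullBoundaryDeriv, PiLp.toLp_apply, Matrix.cons_val_one, Matrix.cons_val_zero]
    ring
  · simp only [Fin.reduceFinMk, hullBoundary_apply_two]
    refine ((((hasDerivAt_sin α).const_mul (2 * √2)).div hDs ps).const_mul t).congr_deriv ?_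
    simp only [hullBoundaryDeriv, PiLp.toLp_apply, Matrix.cons_val]
    ring

theorem hasDerivAt_hullBoundary_ruling (α t : ℝ) :
    HasDerivAt (hullBoundary α) (verticalPoint α - horizontalPoint α) t := by
  have h := (((hasDerivAt_id t).const_sub 1).smul_const (horizontalPoint α)).add
    ((hasDerivAt_id t).smul_const (verticalPoint α))
  refine h.congr_deriv ?_
  simp [sub_eq_add_neg, add_comm]

/-- By Lagrange's identity the Gram determinant is the squared norm of the cross product. That
product is `-rulingDensity α t` times the conormal, whose squared norm is 2 + (cos² α - sin² α)² /
4. -/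
theorem gram_hullBoundary (α t : ℝ) :
    inner ℝ (hullBoundaryDeriv α t) (hullBoundaryDeriv α t) *
        inner ℝ (verticalPoint α - horizontalPoint α) (verticalPoint α - horizontalPoint α) -
      inner ℝ (hullBoundaryDeriv α t) (verticalPoint α - horizontalPoint α) ^ 2 =
    areaDensity α t ^ 2 := by
  have h2 : √2 ^ 2 = 2 := Real.sq_sqrt (by norm_num)
  have hcs := sin_sq_add_cos_sq α
  rw [areaDensity, mul_pow, Real.sq_sqrt (by positivity)]
  simp only [PiLp.inner_apply, Fin.sum_univ_three, PiLp.sub_apply, RCLike.inner_apply, conj_trivial,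
    hullBoundaryDeriv, verticalPoint, horizontalPoint, Matrix.cons_val_zero,
    Matrix.cons_val_one, Matrix.cons_val, rulingDensity]
  have pc : (1 + 2 * cos α ^ 2 : ℝ) ≠ 0 := by positivity
  have ps : (1 + 2 * sin α ^ 2 : ℝ) ≠ 0 := by positivity
  generalize √2 = r at *
  generalize cos α = C at *
  generalize sin α = S at *
  set l := (1 - t) * (16 * S ^ 2 / ((1 + 2 * C ^ 2) ^ 2 * (1 + 2 * S ^ 2))) +
    t * (16 * C ^ 2 / ((1 + 2 * S ^ 2) ^ 2 * (1 + 2 * C ^ 2))) with hl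
  set x := (1 - t) * (2 * r * (S * (2 * C ^ 2 - 1)) / (1 + 2 * C ^ 2) ^ 2) with hx
  set y := -8 * (C * S) * ((1 - t) / (1 + 2 * C ^ 2) ^ 2 + t / (1 + 2 * S ^ 2) ^ 2) with hy
  set z := t * (2 * r * (C * (1 - 2 * S ^ 2)) / (1 + 2 * S ^ 2) ^ 2) with hz
  -- `e1`, `e2` and `e3` are the three coordinates of the cross product.
  have e1 : y * (2 * r * S / (1 + 2 * S ^ 2) - 0) -
      z * (2 / (1 + 2 * S ^ 2) - -2 / (1 + 2 * C ^ 2)) = - (r * C) * l := by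
    rw [hl, hy, hz]
    field_simp
    grind
  have e2 : z * (0 - 2 * r * C / (1 + 2 * C ^ 2)) - x * (2 * r * S / (1 + 2 * S ^ 2) - 0) =
      - ((C ^ 2 - S ^ 2) / 2) * l := by
    rw [hl, hx, hz]
    field_simp
    grind
  have e3 : x * (2 / (1 + 2 * S ^ 2) - -2 / (1 + 2 * C ^ 2)) -
      y * (0 - 2 * r * C / (1 + 2 * C ^ 2)) = - (r * S) * l := by
    rw [hl, hx, hy]
    field_simp
    grind
  have e4 : r ^ 2 * C ^ 2 + r ^ 2 * S ^ 2 = 2 := by rw [h2]; linarith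
  clear_value l x y z
  generalize 2 * r * S / (1 + 2 * S ^ 2) - 0 = w at *
  generalize 2 / (1 + 2 * S ^ 2) - -2 / (1 + 2 * C ^ 2) = v at *
  generalize 0 - 2 * r * C / (1 + 2 * C ^ 2) = u at *
  linear_combination (y * w - z * v - r * C * l) * e1 +
    (z * u - x * w - (C ^ 2 - S ^ 2) / 2 * l) * e2 + (x * v - y * u - r * S * l) * e3 + l ^ 2 * e4

theorem areaDensity_nonneg (α : ℝ) {t : ℝ} (ht : t ∈ Icc (0 : ℝ) 1) : 0 ≤ areaDensity α t := by
  have h1 : 0 ≤ 1 - t := by linarith [ht.2]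
  have h2 := ht.1
  unfold areaDensity rulingDensity
  positivity

/-- This makes the chart an immersion. The ends must be excluded: at t = 0 the density vanishes when
sin α = 0, and at t = 1 when cos α = 0. -/
theorem areaDensity_pos (α : ℝ) {t : ℝ} (ht : t ∈ Ioo (0 : ℝ) 1) : 0 < areaDensity α t := by
  have h1 : 0 < 1 - t := by linarith [ht.2]
  have h2 := ht.1
  unfold areaDensity rulingDensity
  refine mul_pos (by positivity) ?_
  rcases eq_or_ne (sin α) 0 with hs | hs
  · have : cos α ≠ 0 := fun hc => by simpa [hs, hc] using sin_sq_add_cos_sq α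
    positivity
  · positivity

/-! ### Surface area as an integral over the parameters. -/

/-- `hullBoundary` as a map on the Euclidean plane. -/
noncomputable def hullChart (x : EuclideanSpace ℝ (Fin 2)) : EuclideanSpace ℝ (Fin 3) :=
  hullBoundary (x 0) (x 1)

theorem contDiff_hullChart : ContDiff ℝ 1 hullChart := by
  have pc : ∀ α : ℝ, (1 + 2 * cos α ^ 2 : ℝ) ≠ 0 := fun α => by positivity
  have ps : ∀ α : ℝ, (1 + 2 * sin α ^ 2 : ℝ) ≠ 0 := fun α => by positivity
  have h0 : ContDiff ℝ 1 fun x : EuclideanSpace ℝ (Fin 2) => x 0 := contDiff_euclidean.1 contDiff_id 0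
  have h1 : ContDiff ℝ 1 fun x : EuclideanSpace ℝ (Fin 2) => x 1 := contDiff_euclidean.1 contDiff_id 1
  have hc := Real.contDiff_cos.comp h0
  have hs := Real.contDiff_sin.comp h0
  simp only [Function.comp_def] at hc hs
  rw [contDiff_euclidean]
  intro i
  fin_cases i
  · simp only [hullChart, hullBoundary_apply_zero, Fin.zero_eta]
    exact (contDiff_const.sub h1).mul ((contDiff_const.mul hc).div
      (contDiff_const.add (contDiff_const.mul (hc.pow 2))) fun x => pc _)
  · simp only [hullChart, hullBoundary_apply_one, Fin.mk_one]
    exact ((contDiff_const.sub h1).mul (contDiff_const.div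
      (contDiff_const.add (contDiff_const.mul (hc.pow 2))) fun x => pc _)).add
      (h1.mul (contDiff_const.div
      (contDiff_const.add (contDiff_const.mul (hs.pow 2))) fun x => ps _))
  · simp only [hullChart, hullBoundary_apply_two, Fin.reduceFinMk]
    exact h1.mul ((contDiff_const.mul hs).div
      (contDiff_const.add (contDiff_const.mul (hs.pow 2))) fun x => ps _)

theorem hasFDerivAt_hullChart (x : EuclideanSpace ℝ (Fin 2)) :
    HasFDerivAt hullChart (fderiv ℝ hullChart x) x :=
  (contDiff_hullChart.differentiable one_ne_zero x).hasFDerivAt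

theorem fderiv_hullChart_single_zero (x : EuclideanSpace ℝ (Fin 2)) :
    fderiv ℝ hullChart x (EuclideanSpace.single 0 1) = hullBoundaryDeriv (x 0) (x 1) := by
  have h := (hasFDerivAt_hullChart x).hasLineDerivAt (EuclideanSpace.single 0 1)
  rw [HasLineDerivAt] at h
  refine h.unique ?_
  have h2 := (hasDerivAt_hullBoundary_angle (x 0 + 0) (x 1)).comp_const_add (x 0) 0
  simpa [hullChart] using h2

theorem fderiv_hullChart_single_one (x : EuclideanSpace ℝ (Fin 2)) :
    fderiv ℝ hullChart x (EuclideanSpace.single 1 1) =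
      verticalPoint (x 0) - horizontalPoint (x 0) := by
  have h := (hasFDerivAt_hullChart x).hasLineDerivAt (EuclideanSpace.single 1 1)
  rw [HasLineDerivAt] at h
  refine h.unique ?_
  have h2 := (hasDerivAt_hullBoundary_ruling (x 0) (x 1 + 0)).comp_const_add (x 1) 0
  simpa [hullChart] using h2

theorem normDet_fderiv_hullChart {x : EuclideanSpace ℝ (Fin 2)} (hx : x 1 ∈ Icc (0 : ℝ) 1) :
    (fderiv ℝ hullChart x).toLinearMap.normDet = areaDensity (x 0) (x 1) := by
  have h := (fderiv ℝ hullChart x).toLinearMap.normDet_sq_eq_det_gram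
    (EuclideanSpace.basisFun (Fin 2) ℝ)
  rw [← sq_eq_sq₀ (LinearMap.normDet_nonneg _) (areaDensity_nonneg _ hx), ← gram_hullBoundary,
    ← fderiv_hullChart_single_zero, ← fderiv_hullChart_single_one]
  simp only [Matrix.det_fin_two, Matrix.gram_apply, EuclideanSpace.basisFun_apply,
    ContinuousLinearMap.coe_coe, RCLike.ofReal_real_eq_id, id_eq] at h
  rw [h]
  set a := fderiv ℝ hullChart x (EuclideanSpace.single 0 1)
  set b := fderiv ℝ hullChart x (EuclideanSpace.single 1 1)
  linear_combination -(inner ℝ a b) * real_inner_comm a b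

/-- The parameter domain: one period in the angle, open rulings. -/
def hullDomain : Set (EuclideanSpace ℝ (Fin 2)) :=
  {x | x 0 ∈ Ioc (-π) π ∧ x 1 ∈ Ioo (0 : ℝ) 1}

theorem measurableSet_hullDomain : MeasurableSet hullDomain :=
  (measurableSet_Ioc.preimage (by fun_prop : Measurable fun x : EuclideanSpace ℝ (Fin 2) => x 0)).inter
    (measurableSet_Ioo.preimage (by fun_prop : Measurable fun x : EuclideanSpace ℝ (Fin 2) => x 1))

theorem euclideanHausdorffMeasure_hullChart_image :
    Measure.euclideanHausdorffMeasure 2 (hullChart '' hullDomain) =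
      ∫⁻ x in hullDomain, ENNReal.ofReal (areaDensity (x 0) (x 1)) := by
  have hdet : ∀ x ∈ hullDomain,
      (fderiv ℝ hullChart x).toLinearMap.normDet = areaDensity (x 0) (x 1) :=
    fun x hx => normDet_fderiv_hullChart (Ioo_subset_Icc_self hx.2)
  have h := euclideanHausdorffMeasure_image_eq_lintegral_normDet (f := hullChart)
    (f' := fderiv ℝ hullChart) measurableSet_hullDomain
    (fun x _ => contDiff_hullChart.contDiffAt.hasStrictFDerivAt one_ne_zero)
    (contDiff_hullChart.continuous_fderiv one_ne_zero).continuousOn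
    (fun x hx => ((LinearMap.normDet_ne_zero_tfae _).out 0 4).1
      ((hdet x hx).trans_ne (areaDensity_pos _ hx.2).ne'))
    (fun x hx y hy hxy => by
      have := @hullBoundary_injOn (x 0, x 1) hx (y 0, y 1) hy hxy
      rw [Prod.mk.injEq] at this
      ext i
      fin_cases i
      exacts [this.1, this.2])
  rw [finrank_euclideanSpace_fin] at h
  rw [h]
  exact setLIntegral_congr_fun measurableSet_hullDomain fun x hx => by simp only [hdet x hx]

theorem euclideanHausdorffMeasure_two_range_eq_zero {f : ℝ → EuclideanSpace ℝ (Fin 3)}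
    (hf : ContDiff ℝ 1 f) : Measure.euclideanHausdorffMeasure 2 (range f) = 0 := by
  have h : μH[((2 : NNReal) : ℝ)] (range f) = 0 := by
    refine hausdorffMeasure_of_dimH_lt (lt_of_le_of_lt hf.dimH_range_le ?_)
    rw [Module.finrank_self]
    norm_num
  rw [Measure.euclideanHausdorffMeasure_def, Measure.smul_apply]
  simp only [NNReal.coe_ofNat] at h
  simp [h]

/-- The rulings' endpoints t = 0 and t = 1 trace C¹ curves, of dimension at most 1, so dropping them
loses no area. -/
theorem surfaceArea_twoDiskHull_eq_lintegral : surfaceArea twoDiskHull =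
    ∫⁻ x in hullDomain, ENNReal.ofReal (areaDensity (x 0) (x 1)) := by
  have hpt : ∀ t : ℝ, ContDiff ℝ 1 fun α => hullBoundary α t := fun t => by
    have hγ : ContDiff ℝ 1 fun α : ℝ => !₂[α, t] := by
      rw [contDiff_euclidean]
      intro i
      fin_cases i
      · exact contDiff_id
      · exact contDiff_const
    simpa [hullChart, Function.comp_def] using contDiff_hullChart.comp hγ
  rw [← euclideanHausdorffMeasure_hullChart_image, surfaceArea]
  refine le_antisymm ?_ (measure_mono ?_)
  · have hsub : frontier twoDiskHull ⊆ hullChart '' hullDomain ∪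
        (range (fun α => hullBoundary α 0) ∪ range (fun α => hullBoundary α 1)) := by
      intro p hp
      obtain ⟨α, hα, t, ht, rfl⟩ := frontier_twoDiskHull_subset hp
      rcases ht.1.eq_or_lt with rfl | h0
      · exact Or.inr (Or.inl ⟨α, rfl⟩)
      rcases ht.2.eq_or_lt with rfl | h1
      · exact Or.inr (Or.inr ⟨α, rfl⟩)
      · exact Or.inl ⟨!₂[α, t], ⟨by simpa using hα, by simpa using ⟨h0, h1⟩⟩, by simp [hullChart]⟩
    refine (measure_mono hsub).trans ((measure_union_le _ _).trans ?_)
    rw [measure_union_null (euclideanHausdorffMeasure_two_range_eq_zero (hpt 0))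
      (euclideanHausdorffMeasure_two_range_eq_zero (hpt 1)), add_zero]
  · rintro _ ⟨x, hx, rfl⟩
    exact hullBoundary_mem_frontier _ (Ioo_subset_Icc_self hx.2)

/-- The area density of the hull integrated along a ruling. -/
noncomputable def rulingArea (α : ℝ) : ℝ :=
  √(2 + (cos α ^ 2 - sin α ^ 2) ^ 2 / 4) *
    (8 * (1 + 2 * (cos α ^ 4 + sin α ^ 4)) /
      ((1 + 2 * cos α ^ 2) ^ 2 * (1 + 2 * sin α ^ 2) ^ 2))

/-- The density is affine in t, so its integral is the mean of its two end values. -/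
theorem integral_areaDensity (α : ℝ) : ∫ t in (0 : ℝ)..1, areaDensity α t = rulingArea α := by
  have pc : (1 + 2 * cos α ^ 2 : ℝ) ≠ 0 := by positivity
  have ps : (1 + 2 * sin α ^ 2 : ℝ) ≠ 0 := by positivity
  unfold areaDensity rulingDensity rulingArea
  rw [intervalIntegral.integral_const_mul, intervalIntegral.integral_add
    (by apply Continuous.intervalIntegrable; fun_prop)
    (by apply Continuous.intervalIntegrable; fun_prop),
    intervalIntegral.integral_mul_const, intervalIntegral.integral_mul_const,
    intervalIntegral.integral_sub (by simp) (by simp)]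
  simp only [integral_id, intervalIntegral.integral_const, smul_eq_mul, sub_zero, one_pow,
    ne_eq, OfNat.ofNat_ne_zero, not_false_eq_true, zero_pow, mul_one]
  congr 1
  field_simp
  have := sin_sq_add_cos_sq α
  grind

theorem continuous_areaDensity : Continuous fun x : ℝ × ℝ => areaDensity x.1 x.2 := by
  unfold areaDensity rulingDensity
  have pc : ∀ α : ℝ, (1 + 2 * cos α ^ 2 : ℝ) ≠ 0 := fun α => by positivity
  have ps : ∀ α : ℝ, (1 + 2 * sin α ^ 2 : ℝ) ≠ 0 := fun α => by positivity
  fun_prop (disch := intros; positivity)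

theorem surfaceArea_twoDiskHull_eq_integral :
    surfaceArea twoDiskHull = ENNReal.ofReal (∫ α in (-π)..π, rulingArea α) := by
  set e := (MeasurableEquiv.toLp 2 (Fin 2 → ℝ)).symm.trans MeasurableEquiv.finTwoArrow with he
  have hmp : MeasurePreserving e volume volume :=
    (EuclideanSpace.volume_preserving_symm_measurableEquiv_toLp (Fin 2)).trans
      (volume_preserving_finTwoArrow ℝ)
  have hint : IntegrableOn (fun x : ℝ × ℝ => areaDensity x.1 x.2)
      (Ioc (-π) π ×ˢ Ioo (0 : ℝ) 1) := by
    refine (continuous_areaDensity.continuousOn.integrableOn_compact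
      (isCompact_Icc.prod isCompact_Icc)).mono_set
      (prod_mono Ioc_subset_Icc_self Ioo_subset_Icc_self)
  have hset : hullDomain = e ⁻¹' (Ioc (-π) π ×ˢ Ioo (0 : ℝ) 1) := rfl
  have h1 : ∫⁻ x in hullDomain, ENNReal.ofReal (areaDensity (x 0) (x 1)) =
      ∫⁻ x in Ioc (-π) π ×ˢ Ioo (0 : ℝ) 1, ENNReal.ofReal (areaDensity x.1 x.2) := by
    rw [hset]
    exact hmp.setLIntegral_comp_preimage_emb e.measurableEmbedding
      (fun x : ℝ × ℝ => ENNReal.ofReal (areaDensity x.1 x.2)) _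
  rw [surfaceArea_twoDiskHull_eq_lintegral, h1, ← ofReal_integral_eq_lintegral_ofReal hint
    (by
      filter_upwards [ae_restrict_mem (measurableSet_Ioc.prod measurableSet_Ioo)] with x hx
      exact areaDensity_nonneg _ (Ioo_subset_Icc_self hx.2))]
  congr 1
  rw [Measure.volume_eq_prod] at hint ⊢
  rw [setIntegral_prod _ hint, intervalIntegral.integral_of_le (by linarith [pi_pos])]
  refine setIntegral_congr_fun measurableSet_Ioc fun α _ => ?_
  simp only
  rw [← integral_areaDensity, intervalIntegral.integral_of_le zero_le_one,
    integral_Ioc_eq_integral_Ioo]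

/-! ### Reduction to a trigonometric integral and to the integral in v. -/

/-- The trigonometric form of the area integrand. -/
noncomputable def trigIntegrand (θ : ℝ) : ℝ :=
  (3 - sin θ ^ 2) / (3 + sin θ ^ 2) ^ 2 * √(1 - 1 / 9 * sin θ ^ 2)

theorem one_sub_ninth_sin_sq_pos (θ : ℝ) : 0 < 1 - 1 / 9 * sin θ ^ 2 := by
  nlinarith [sin_sq_le_one θ]

theorem continuous_trigIntegrand : Continuous trigIntegrand := by
  unfold trigIntegrand
  fun_prop (disch := intros; positivity)

theorem trigIntegrand_periodic : Function.Periodic trigIntegrand π := fun θ => by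
  simp [trigIntegrand, sin_add_pi]

theorem integral_zero_pi_trigIntegrand :
    ∫ θ in (0 : ℝ)..π, trigIntegrand θ = 2 * ∫ θ in (0 : ℝ)..(π / 2), trigIntegrand θ := by
  have hi : ∀ a b, IntervalIntegrable trigIntegrand volume a b :=
    fun a b => continuous_trigIntegrand.intervalIntegrable a b
  rw [← intervalIntegral.integral_add_adjacent_intervals (hi 0 (π / 2)) (hi (π / 2) π), two_mul]
  congr 1
  have h := intervalIntegral.integral_comp_sub_left trigIntegrand (a := 0) (b := π / 2) π
  rw [show π - π / 2 = π / 2 by ring, sub_zero] at h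
  rw [← h]
  simp [trigIntegrand, sin_pi_sub]

/-- The expression is symmetric in cos² α and sin² α, whose sum is 1, so it depends only on their
product sin² 2α / 4. -/
theorem rulingArea_eq (α : ℝ) : rulingArea α = 12 * trigIntegrand (2 * α) := by
  have hcs := sin_sq_add_cos_sq α
  have h1 : √(2 + (cos α ^ 2 - sin α ^ 2) ^ 2 / 4) =
      3 / 2 * √(1 - 1 / 9 * sin (2 * α) ^ 2) := by
    rw [show (3 / 2 : ℝ) = √(9 / 4) by
      rw [show (9 / 4 : ℝ) = (3 / 2) ^ 2 by norm_num, Real.sqrt_sq (by norm_num)],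
      ← Real.sqrt_mul (by norm_num), sin_two_mul]
    congr 1
    grind
  have h2 : (1 + 2 * cos α ^ 2) ^ 2 * (1 + 2 * sin α ^ 2) ^ 2 = (3 + sin (2 * α) ^ 2) ^ 2 := by
    rw [sin_two_mul, ← mul_pow]
    congr 1
    linear_combination 2 * hcs
  have h3 : 8 * (1 + 2 * (cos α ^ 4 + sin α ^ 4)) = 8 * (3 - sin (2 * α) ^ 2) := by
    rw [sin_two_mul]
    linear_combination 16 * (sin α ^ 2 + cos α ^ 2 + 1) * hcs
  rw [rulingArea, trigIntegrand, h1, h2, h3]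
  ring

/-- The factor 48 is 12 · (1/2) · 4 · 2: the Jacobian of θ = 2α, four periods of length π, and two
equal halves of each. -/
theorem integral_rulingArea : ∫ α in (-π)..π, rulingArea α =
    48 * ∫ θ in (0 : ℝ)..(π / 2), trigIntegrand θ := by
  have h := trigIntegrand_periodic.intervalIntegral_add_zsmul_eq 4 (-(2 * π))
    fun a b => continuous_trigIntegrand.intervalIntegrable a b
  rw [trigIntegrand_periodic.intervalIntegral_add_eq _ 0, zero_add,
    integral_zero_pi_trigIntegrand] at h
  simp only [rulingArea_eq]
  rw [intervalIntegral.integral_const_mul, intervalIntegral.integral_comp_mul_left _ two_ne_zero]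
  rw [show -(2 * π) + (4 : ℤ) • π = 2 * π by simp; ring] at h
  rw [show 2 * -π = -(2 * π) by ring, h]
  simp only [zsmul_eq_mul, smul_eq_mul]
  push_cast
  ring

/-- Here v = -2 / (2 + cos θ) is the y-coordinate of `horizontalPoint` at θ = 2α. The Jacobian's
factor sin θ cancels the inverse square root singularities at v = -2 and v = -2/3. -/
theorem areaIntegrand_comp {θ : ℝ} (hθ : θ ∈ Ioo 0 π) :
    |-(2 * sin θ) / (2 + cos θ) ^ 2| • areaIntegrand (-2 / (2 + cos θ)) = 6 * trigIntegrand θ := by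
  have hs : 0 < sin θ := sin_pos_of_mem_Ioo hθ
  have hcs := sin_sq_add_cos_sq θ
  have hp : 0 < 2 + cos θ := by linarith [neg_one_le_cos θ]
  have hm : 0 < 2 - cos θ := by linarith [cos_le_one θ]
  have habs : |-(2 * sin θ) / (2 + cos θ) ^ 2| = 2 * sin θ / (2 + cos θ) ^ 2 := by
    rw [neg_div, abs_neg, abs_of_pos (by positivity)]
  have hc1 : cos θ - 1 ≠ 0 := by nlinarith [hs, sq_nonneg (cos θ)]
  have hc2 : 1 + cos θ ≠ 0 := by nlinarith [hs, sq_nonneg (cos θ)]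
  have hroot : √(-((1 + 2 * (-2 / (2 + cos θ)) + 3 * (-2 / (2 + cos θ)) ^ 2) /
      ((2 + -2 / (2 + cos θ)) * (2 + 3 * (-2 / (2 + cos θ)))))) =
      3 / 2 * √(1 - 1 / 9 * sin θ ^ 2) / sin θ := by
    rw [Real.sqrt_eq_iff_mul_self_eq_of_pos]
    · rw [show ∀ a b c : ℝ, a * b / c * (a * b / c) = a ^ 2 * b ^ 2 / c ^ 2 by intros; ring,
        Real.sq_sqrt (one_sub_ninth_sin_sq_pos θ).le]
      have e1 : 2 + -2 / (2 + cos θ) = 2 * (1 + cos θ) / (2 + cos θ) := by field_simp; ring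
      have e2 : 2 + 3 * (-2 / (2 + cos θ)) = 2 * (cos θ - 1) / (2 + cos θ) := by field_simp; ring
      have e3 : 1 + 2 * (-2 / (2 + cos θ)) + 3 * (-2 / (2 + cos θ)) ^ 2 =
        (9 - sin θ ^ 2) / (2 + cos θ) ^ 2 := by field_simp; linear_combination hcs
      have e4 : sin θ ^ 2 = - ((1 + cos θ) * (cos θ - 1)) := by linear_combination hcs
      rw [e1, e2, e3, e4]
      field_simp
      ring
    · have := Real.sqrt_pos.2 (one_sub_ninth_sin_sq_pos θ)
      positivity
  rw [habs, areaIntegrand, hroot, trigIntegrand]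
  have e5 : 1 + 2 * (-2 / (2 + cos θ)) = -(2 - cos θ) / (2 + cos θ) := by field_simp; ring
  have e6 : 2 + 4 * (-2 / (2 + cos θ)) + 3 * (-2 / (2 + cos θ)) ^ 2 =
    2 * (3 - sin θ ^ 2) / (2 + cos θ) ^ 2 := by field_simp; linear_combination hcs
  have e7 : 3 + sin θ ^ 2 = (2 - cos θ) * (2 + cos θ) := by linear_combination hcs
  rw [e5, e6, e7, smul_eq_mul]
  field_simp
  ring

theorem image_neg_two_div :
    (fun θ => -2 / (2 + cos θ)) '' Ioo 0 π = Ioo (-2 : ℝ) (-2 / 3) := by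
  ext v
  constructor
  · rintro ⟨θ, hθ, rfl⟩
    have hs : 0 < sin θ := sin_pos_of_mem_Ioo hθ
    have hcs := sin_sq_add_cos_sq θ
    have h1 : -1 < cos θ := by nlinarith [neg_one_le_cos θ]
    have h2 : cos θ < 1 := by nlinarith [cos_le_one θ]
    constructor
    · rw [lt_div_iff₀ (by linarith)]; linarith
    · rw [div_lt_iff₀ (by linarith)]; linarith
  · rintro ⟨h1, h2⟩
    have hv : v < 0 := by linarith
    have h3 : -1 < -2 / v - 2 := by
      have : 1 < -2 / v := by rw [lt_div_iff_of_neg hv]; linarith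
      linarith
    have h4 : -2 / v - 2 < 1 := by
      have : -2 / v < 3 := by rw [div_lt_iff_of_neg hv]; linarith
      linarith
    refine ⟨arccos (-2 / v - 2), ⟨arccos_pos.2 h4, ?_⟩, ?_⟩
    · exact (arccos_le_pi _).lt_of_ne fun h => by
        rw [arccos_eq_pi] at h
        linarith
    · simp only [cos_arccos h3.le h4.le]
      have := hv.ne
      field_simp
      ring

theorem injOn_neg_two_div : InjOn (fun θ => -2 / (2 + cos θ)) (Ioo 0 π) := by
  intro x hx y hy h
  have h1 : 0 < 2 + cos x := by linarith [neg_one_le_cos x]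
  have h2 : 0 < 2 + cos y := by linarith [neg_one_le_cos y]
  simp only at h
  rw [div_eq_div_iff h1.ne' h2.ne'] at h
  exact injOn_cos (Ioo_subset_Icc_self hx) (Ioo_subset_Icc_self hy) (by linarith)

theorem hasDerivAt_neg_two_div (θ : ℝ) :
    HasDerivAt (fun θ => -2 / (2 + cos θ)) (-(2 * sin θ) / (2 + cos θ) ^ 2) θ := by
  have h1 : 2 + cos θ ≠ 0 := by linarith [neg_one_le_cos θ]
  refine ((hasDerivAt_const θ (-2 : ℝ)).div ((hasDerivAt_cos θ).const_add 2) h1).congr_deriv ?_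
  ring

theorem intervalIntegrable_areaIntegrand :
    IntervalIntegrable areaIntegrand volume (-2) (-2 / 3) := by
  rw [intervalIntegrable_iff_integrableOn_Ioo_of_le (by norm_num), ← image_neg_two_div,
    integrableOn_image_iff_integrableOn_abs_deriv_smul measurableSet_Ioo
      (fun θ _ => (hasDerivAt_neg_two_div θ).hasDerivWithinAt) injOn_neg_two_div]
  have h : IntegrableOn (fun θ => 6 * trigIntegrand θ) (Ioo 0 π) :=
    (continuous_const.mul continuous_trigIntegrand).continuousOn.integrableOn_compact
      isCompact_Icc |>.mono_set Ioo_subset_Icc_self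
  exact h.congr_fun (fun θ hθ => (areaIntegrand_comp hθ).symm) measurableSet_Ioo

theorem integral_areaIntegrand : 4 * ∫ v in (-2 : ℝ)..(-2 / 3), areaIntegrand v =
    48 * ∫ θ in (0 : ℝ)..(π / 2), trigIntegrand θ := by
  rw [intervalIntegral.integral_of_le (by norm_num), integral_Ioc_eq_integral_Ioo,
    ← image_neg_two_div, integral_image_eq_integral_abs_deriv_smul measurableSet_Ioo
      (fun θ _ => (hasDerivAt_neg_two_div θ).hasDerivWithinAt) injOn_neg_two_div,
    setIntegral_congr_fun measurableSet_Ioo fun θ hθ => areaIntegrand_comp hθ,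
    ← integral_Ioc_eq_integral_Ioo, ← intervalIntegral.integral_of_le pi_pos.le,
    intervalIntegral.integral_const_mul, integral_zero_pi_trigIntegrand]
  ring

/-! ### Identification with complete elliptic integrals. -/

/-- The integrand of the combination of complete elliptic integrals in `vogtValue`. -/
noncomputable def ellipticIntegrand (θ : ℝ) : ℝ :=
  (1 - sin θ ^ 2 + 24 / (3 + sin θ ^ 2)) / √(1 - 1 / 9 * sin θ ^ 2)

theorem continuous_ellipticIntegrand : Continuous ellipticIntegrand := by
  unfold ellipticIntegrand
  have h : ∀ θ : ℝ, √(1 - 1 / 9 * sin θ ^ 2) ≠ 0 := fun θ =>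
    (Real.sqrt_pos.2 (one_sub_ninth_sin_sq_pos θ)).ne'
  have h' : ∀ θ : ℝ, 3 + sin θ ^ 2 ≠ 0 := fun θ => by positivity
  exact ((continuous_const.sub (continuous_sin.pow 2)).add
    (continuous_const.div (by fun_prop) h')).div (by fun_prop) h

theorem vogtValue_eq_integral :
    vogtValue = 4 / 3 * ∫ θ in (0 : ℝ)..(π / 2), ellipticIntegrand θ := by
  have h : ∀ θ : ℝ, √(1 - 1 / 9 * sin θ ^ 2) ≠ 0 := fun θ =>
    (Real.sqrt_pos.2 (one_sub_ninth_sin_sq_pos θ)).ne'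
  have h' : ∀ θ : ℝ, 1 - -1 / 3 * sin θ ^ 2 ≠ 0 := fun θ => by
    have : 1 - -1 / 3 * sin θ ^ 2 = 1 + sin θ ^ 2 / 3 := by ring
    rw [this]; positivity
  have iE : IntervalIntegrable (fun θ => √(1 - 1 / 9 * sin θ ^ 2)) volume 0 (π / 2) :=
    Continuous.intervalIntegrable (by fun_prop) _ _
  have iK : IntervalIntegrable (fun θ => 1 / √(1 - 1 / 9 * sin θ ^ 2)) volume 0 (π / 2) :=
    Continuous.intervalIntegrable (continuous_const.div (by fun_prop) h) _ _
  have iP : IntervalIntegrable (fun θ => 1 / ((1 - -1 / 3 * sin θ ^ 2) *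
      √(1 - 1 / 9 * sin θ ^ 2))) volume 0 (π / 2) :=
    Continuous.intervalIntegrable
      (continuous_const.div (by fun_prop) fun θ => mul_ne_zero (h' θ) (h θ)) _ _
  rw [vogtValue, ellipticE, ellipticK, ellipticPi, ← intervalIntegral.integral_const_mul,
    ← intervalIntegral.integral_const_mul, ← intervalIntegral.integral_const_mul,
    ← intervalIntegral.integral_sub (iE.const_mul _) (iK.const_mul _),
    ← intervalIntegral.integral_add ((iE.const_mul _).sub (iK.const_mul _)) (iP.const_mul _)]
  congr 1
  refine intervalIntegral.integral_congr fun θ _ => ?_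
  have hsq := Real.sq_sqrt (one_sub_ninth_sin_sq_pos θ).le
  have h3 : 3 + sin θ ^ 2 ≠ 0 := by positivity
  have e : 1 - -1 / 3 * sin θ ^ 2 = (3 + sin θ ^ 2) / 3 := by ring
  simp only [ellipticIntegrand, e]
  have hw := h θ
  generalize √(1 - 1 / 9 * sin θ ^ 2) = w at *
  field_simp
  linear_combination 9 * (3 + sin θ ^ 2) * hsq

/-- The integrands differ by the derivative of a function with factor sin θ cos θ, which vanishes at
0 and π/2. -/
theorem integral_ellipticIntegrand : 4 / 3 * ∫ θ in (0 : ℝ)..(π / 2), ellipticIntegrand θ =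
    48 * ∫ θ in (0 : ℝ)..(π / 2), trigIntegrand θ := by
  have hderiv : ∀ θ : ℝ, HasDerivAt
      (fun θ => -12 * (sin θ * cos θ * √(1 - 1 / 9 * sin θ ^ 2) / (3 + sin θ ^ 2)))
      (4 / 3 * ellipticIntegrand θ - 48 * trigIntegrand θ) θ := by
    intro θ
    have hw := Real.sqrt_pos.2 (one_sub_ninth_sin_sq_pos θ)
    have hsq := Real.sq_sqrt (one_sub_ninth_sin_sq_pos θ).le
    have hcs := sin_sq_add_cos_sq θ
    have h3 : 3 + sin θ ^ 2 ≠ 0 := by positivity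
    have h1 := ((hasDerivAt_sin θ).fun_pow 2).const_mul (1 / 9) |>.const_sub 1 |>.sqrt
      (one_sub_ninth_sin_sq_pos θ).ne'
    have h2 := ((((hasDerivAt_sin θ).mul (hasDerivAt_cos θ)).mul h1).div
      (((hasDerivAt_sin θ).fun_pow 2).const_add 3) h3).const_mul (-12)
    refine h2.congr_deriv ?_
    rw [ellipticIntegrand, trigIntegrand]
    simp only [Pi.mul_apply]
    generalize √(1 - 1 / 9 * sin θ ^ 2) = w at *
    generalize sin θ = s at *
    generalize cos θ = c at *
    have hw' := hw.ne'
    field_simp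
    have hc2 : c ^ 2 = 1 - s ^ 2 := by linarith
    have hw2 : w ^ 2 = 1 - 1 / 9 * s ^ 2 := hsq
    clear hsq hcs h1 h2 hw hw'
    push_cast
    ring_nf
    grind
  have iE := continuous_ellipticIntegrand.intervalIntegrable (μ := volume) 0 (π / 2)
  have iT := continuous_trigIntegrand.intervalIntegrable (μ := volume) 0 (π / 2)
  have h := intervalIntegral.integral_eq_sub_of_hasDerivAt (a := 0) (b := π / 2)
    (fun θ _ => hderiv θ) ((iE.const_mul _).sub (iT.const_mul _))
  rw [intervalIntegral.integral_sub (iE.const_mul _) (iT.const_mul _),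
    intervalIntegral.integral_const_mul, intervalIntegral.integral_const_mul] at h
  simp at h
  linarith

/-! ### Numerical evaluation. -/

theorem integral_sin_pow_even_half (k : ℕ) : ∫ θ in (0 : ℝ)..(π / 2), sin θ ^ (2 * k) =
    π / 2 * ∏ i ∈ Finset.range k, ((2 * i + 1 : ℝ) / (2 * i + 2)) := by
  induction k with
  | zero => simp
  | succ k ih =>
    rw [mul_add_one, integral_sin_pow, ih, Finset.prod_range_succ]
    simp
    ring

theorem integral_inv_three_add_sin_sq :
    ∫ θ in (0 : ℝ)..(π / 2), 1 / (3 + sin θ ^ 2) = π / (4 * √3) := by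
  have h3 : √3 ^ 2 = 3 := Real.sq_sqrt (by norm_num)
  have h3p : 0 < √3 := by positivity
  have h3l : √3 < 7 / 4 := by rw [Real.sqrt_lt' (by norm_num)]; norm_num
  have h3g : 3 / 2 < √3 := by rw [Real.lt_sqrt (by norm_num)]; norm_num
  -- Since 3 + sin² θ = (7 - cos 2θ) / 2, the integrand is a Poisson kernel whose parameter k is the
  -- root in (0, 1) of k² - 14k + 1 = 0. The antiderivative below is smooth on the whole line,
  -- unlike the usual one through tan θ, singular at π/2.
  set k : ℝ := 7 - 4 * √3 with hk
  have hk2 : k ^ 2 + 1 = 14 * k := by rw [hk]; linear_combination 16 * h3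
  have hk0 : 0 < k := by linarith
  have hk1 : k < 1 := by linarith
  have hden : ∀ θ : ℝ, 0 < 1 - k * cos (2 * θ) := fun θ => by
    nlinarith [cos_le_one (2 * θ)]
  have hderiv : ∀ θ : ℝ, HasDerivAt
      (fun θ => (θ + arctan (k * sin (2 * θ) / (1 - k * cos (2 * θ)))) / (2 * √3))
      (1 / (3 + sin θ ^ 2)) θ := by
    intro θ
    have hd := (hden θ).ne'
    have h2 : HasDerivAt (fun θ : ℝ => 2 * θ) 2 θ := by
      simpa using (hasDerivAt_id θ).const_mul 2
    have h := ((hasDerivAt_id' θ).add ((h2.sin.const_mul k).div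
      ((h2.cos.const_mul k).const_sub 1) hd).arctan).div_const (2 * √3)
    refine h.congr_deriv ?_
    have hcs := sin_sq_add_cos_sq (2 * θ)
    have e : 3 + sin θ ^ 2 = (7 - cos (2 * θ)) / 2 := by rw [sin_sq_eq_half_sub]; ring
    rw [e]
    have h7 : 0 < 7 - cos (2 * θ) := by linarith [cos_le_one (2 * θ)]
    simp only [Pi.div_apply]
    generalize cos (2 * θ) = c at *
    generalize sin (2 * θ) = s at *
    have hone : 1 + (k * s / (1 - k * c)) ^ 2 = 2 * k * (7 - c) / (1 - k * c) ^ 2 := by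
      field_simp
      linear_combination k ^ 2 * hcs + hk2
    rw [hone]
    have h7' := h7.ne'
    field_simp
    have hs2 : s ^ 2 = 1 - c ^ 2 := by linarith
    clear_value k
    clear h hone hden e
    ring_nf
    grind
  have hcont : Continuous fun θ : ℝ => 1 / (3 + sin θ ^ 2) :=
    continuous_const.div (by fun_prop) fun θ => by positivity
  rw [intervalIntegral.integral_eq_sub_of_hasDerivAt (fun θ _ => hderiv θ)
    (hcont.intervalIntegrable _ _)]
  simp only [mul_zero, sin_zero, zero_div, arctan_zero, show 2 * (π / 2) = π by ring, sin_pi]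
  field_simp
  ring

/-- The degree `7` Taylor polynomial of `(1 - x) ^ (-1 / 2)`. -/
noncomputable def invSqrtTaylor (x : ℝ) : ℝ :=
  1 + 1 / 2 * x + 3 / 8 * x ^ 2 + 5 / 16 * x ^ 3 + 35 / 128 * x ^ 4 + 63 / 256 * x ^ 5 +
    231 / 1024 * x ^ 6 + 429 / 2048 * x ^ 7

theorem invSqrtTaylor_bounds {x : ℝ} (h0 : 0 ≤ x) (h1 : x ≤ 1 / 9) :
    invSqrtTaylor x ≤ 1 / √(1 - x) ∧ 1 / √(1 - x) ≤ invSqrtTaylor x + 1 / 10 ^ 8 := by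
  have hx : 0 < 1 - x := by linarith
  have hw := Real.sqrt_pos.2 hx
  have hQ1 : 1 ≤ invSqrtTaylor x := by
    have : 0 ≤ 1 / 2 * x + 3 / 8 * x ^ 2 + 5 / 16 * x ^ 3 + 35 / 128 * x ^ 4 +
      63 / 256 * x ^ 5 + 231 / 1024 * x ^ 6 + 429 / 2048 * x ^ 7 := by positivity
    unfold invSqrtTaylor
    linarith
  set R : ℝ := x ^ 8 * (6435 / 16384 + 715 / 4096 * x + 3861 / 32768 * x ^ 2 +
    2925 / 32768 * x ^ 3 + 75075 / 1048576 * x ^ 4 + 31185 / 524288 * x ^ 5 +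
    212355 / 4194304 * x ^ 6 + 184041 / 4194304 * x ^ 7) with hR
  -- Both bounds are compared after squaring; the defect R has order x⁸ and positive coefficients,
  -- so its maximum is at x = 1/9.
  have hQ : 1 - (1 - x) * invSqrtTaylor x ^ 2 = R := by
    rw [hR, invSqrtTaylor]
    ring
  have hR0 : 0 ≤ R := by positivity
  have hR1 : R ≤ 1 / 10 ^ 8 := by
    calc R ≤ (1 / 9) ^ 8 * (6435 / 16384 + 715 / 4096 * (1 / 9) + 3861 / 32768 * (1 / 9) ^ 2 +
        2925 / 32768 * (1 / 9) ^ 3 + 75075 / 1048576 * (1 / 9) ^ 4 +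
        31185 / 524288 * (1 / 9) ^ 5 + 212355 / 4194304 * (1 / 9) ^ 6 +
        184041 / 4194304 * (1 / 9) ^ 7) := by rw [hR]; gcongr
      _ ≤ 1 / 10 ^ 8 := by norm_num
  constructor
  · rw [le_div_iff₀ hw, ← sq_le_sq₀ (by positivity) zero_le_one, mul_pow, Real.sq_sqrt hx.le]
    linarith
  · rw [div_le_iff₀ hw, ← sq_le_sq₀ zero_le_one (by positivity), mul_pow, Real.sq_sqrt hx.le]
    nlinarith

theorem integral_sum_sin_pow_even (c : ℕ → ℝ) (n : ℕ) :
    ∫ θ in (0 : ℝ)..(π / 2), ∑ k ∈ Finset.range n, c k * sin θ ^ (2 * k) =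
      π / 2 * ∑ k ∈ Finset.range n, c k * ∏ i ∈ Finset.range k, ((2 * i + 1 : ℝ) / (2 * i + 2)) := by
  rw [intervalIntegral.integral_finsetSum fun k _ => Continuous.intervalIntegrable (by fun_prop) _ _,
    Finset.mul_sum]
  refine Finset.sum_congr rfl fun k _ => ?_
  rw [intervalIntegral.integral_const_mul, integral_sin_pow_even_half]
  ring

theorem integral_taylor_main :
    ∫ θ in (0 : ℝ)..(π / 2),
        (1 - sin θ ^ 2 + 24 / (3 + sin θ ^ 2)) * invSqrtTaylor (1 / 9 * sin θ ^ 2) =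
      π * (57992137777345 / 71328803586048) + 1292935 / 62208 * (π / (4 * √3)) := by
  -- Quotient of the polynomial division by 3 + sin² θ; the remainder 1292935/62208 is 24 times
  -- `invSqrtTaylor (-1 / 3)`. Only the nine listed entries are used, never the default 0.
  set c : ℕ → ℝ := fun k => [386681 / 186624, -479993 / 559872, -72103 / 1679616,
    -17321 / 5038848, -4657 / 15116544, -691 / 22674816, -1465 / 544195584, -1243 / 3265173504,
    -143 / 3265173504].getD k 0 with hc
  have hcont : Continuous fun θ : ℝ => 1 / (3 + sin θ ^ 2) :=
    continuous_const.div (by fun_prop) fun θ => by positivity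
  have hpt : ∀ θ : ℝ,
      (1 - sin θ ^ 2 + 24 / (3 + sin θ ^ 2)) * invSqrtTaylor (1 / 9 * sin θ ^ 2) =
        ∑ k ∈ Finset.range 9, c k * sin θ ^ (2 * k) +
          1292935 / 62208 * (1 / (3 + sin θ ^ 2)) := by
    intro θ
    have h3 : 3 + sin θ ^ 2 ≠ 0 := by positivity
    simp only [hc, Finset.sum_range_succ, Finset.sum_range_zero, List.getD_cons_zero,
      List.getD_cons_succ, invSqrtTaylor]
    field_simp
    ring
  simp only [hpt]
  rw [intervalIntegral.integral_add (Continuous.intervalIntegrable (by fun_prop) _ _)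
    ((hcont.intervalIntegrable _ _).const_mul _), intervalIntegral.integral_const_mul,
    integral_inv_three_add_sin_sq, integral_sum_sin_pow_even]
  simp only [hc, Finset.sum_range_succ, Finset.sum_range_zero, List.getD_cons_zero,
    List.getD_cons_succ, Finset.prod_range_succ, Finset.prod_range_zero]
  norm_num
  ring

theorem abs_vogtValue_sub_lt : |vogtValue - 15.97163| < 5 / 10 ^ 6 := by
  have h3 : ∀ θ : ℝ, 3 + sin θ ^ 2 ≠ 0 := fun θ => by positivity
  have hcT : Continuous fun θ : ℝ =>
      (1 - sin θ ^ 2 + 24 / (3 + sin θ ^ 2)) * invSqrtTaylor (1 / 9 * sin θ ^ 2) := by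
    unfold invSqrtTaylor
    exact ((continuous_const.sub (continuous_sin.pow 2)).add
      (continuous_const.div (by fun_prop) h3)).mul (by fun_prop)
  have hweight : ∀ θ : ℝ, 0 ≤ 1 - sin θ ^ 2 + 24 / (3 + sin θ ^ 2) ∧
      1 - sin θ ^ 2 + 24 / (3 + sin θ ^ 2) ≤ 9 := by
    intro θ
    have h1 := sin_sq_le_one θ
    have h0 := sq_nonneg (sin θ)
    have h8 : 24 / (3 + sin θ ^ 2) ≤ 8 := by rw [div_le_iff₀ (by positivity)]; linarith
    have h8' : 0 ≤ 24 / (3 + sin θ ^ 2) := by positivity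
    constructor <;> linarith
  have hb : ∀ θ : ℝ, invSqrtTaylor (1 / 9 * sin θ ^ 2) ≤ 1 / √(1 - 1 / 9 * sin θ ^ 2) ∧
      1 / √(1 - 1 / 9 * sin θ ^ 2) ≤ invSqrtTaylor (1 / 9 * sin θ ^ 2) + 1 / 10 ^ 8 :=
    fun θ => invSqrtTaylor_bounds (by positivity) (by linarith [sin_sq_le_one θ])
  have hpi2 : 0 ≤ π / 2 := by positivity
  have hlow : ∫ θ in (0 : ℝ)..(π / 2),
      (1 - sin θ ^ 2 + 24 / (3 + sin θ ^ 2)) * invSqrtTaylor (1 / 9 * sin θ ^ 2) ≤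
      ∫ θ in (0 : ℝ)..(π / 2), ellipticIntegrand θ := by
    refine intervalIntegral.integral_mono_on hpi2 (hcT.intervalIntegrable _ _)
      (continuous_ellipticIntegrand.intervalIntegrable _ _) fun θ _ => ?_
    rw [ellipticIntegrand, div_eq_mul_one_div (1 - sin θ ^ 2 + 24 / (3 + sin θ ^ 2))]
    exact mul_le_mul_of_nonneg_left (hb θ).1 (hweight θ).1
  -- The weight is at most 9 and the Taylor error at most 10⁻⁸, hence the slack 9 / 10⁸ per unit
  -- length.
  have hup : ∫ θ in (0 : ℝ)..(π / 2), ellipticIntegrand θ ≤ (∫ θ in (0 : ℝ)..(π / 2),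
      (1 - sin θ ^ 2 + 24 / (3 + sin θ ^ 2)) * invSqrtTaylor (1 / 9 * sin θ ^ 2)) +
        π / 2 * (9 / 10 ^ 8) := by
    have hconst : ∫ _ in (0 : ℝ)..(π / 2), (9 / 10 ^ 8 : ℝ) = π / 2 * (9 / 10 ^ 8) := by
      rw [intervalIntegral.integral_const, smul_eq_mul, sub_zero]
    rw [← hconst, ← intervalIntegral.integral_add (hcT.intervalIntegrable _ _) (by simp)]
    refine intervalIntegral.integral_mono_on hpi2
      (continuous_ellipticIntegrand.intervalIntegrable _ _)
      ((hcT.add continuous_const).intervalIntegrable _ _) fun θ _ => ?_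
    rw [ellipticIntegrand, div_eq_mul_one_div (1 - sin θ ^ 2 + 24 / (3 + sin θ ^ 2))]
    have := mul_le_mul_of_nonneg_left (hb θ).2 (hweight θ).1
    linarith [(hweight θ).2]
  rw [integral_taylor_main] at hlow hup
  rw [vogtValue_eq_integral]
  have p1 := pi_gt_d20
  have p2 := pi_lt_d20
  have h3p : 0 < √3 := by positivity
  have s1 : 1.7320508 < √3 := by rw [Real.lt_sqrt (by norm_num)]; norm_num
  have s2 : √3 < 1.7320509 := by rw [Real.sqrt_lt' (by norm_num)]; norm_num
  have hq1 : 3.14159265358979 / (4 * 1.7320509) ≤ π / (4 * √3) := by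
    have : (3.14159265358979 : ℝ) ≤ π := by linarith
    gcongr
  have hq2 : π / (4 * √3) ≤ 3.14159265358980 / (4 * 1.7320508) := by
    have : π ≤ (3.14159265358980 : ℝ) := by linarith
    gcongr
  norm_num at hq1 hq2 p1 p2 hlow hup ⊢
  rw [abs_lt]
  constructor <;> linarith

theorem mainTheorem7 :
    surfaceArea twoDiskHull = ENNReal.ofReal vogtValue ∧
    IntervalIntegrable areaIntegrand volume (-2) (-2 / 3) ∧
    4 * ∫ v in (-2 : ℝ)..(-2 / 3), areaIntegrand v = vogtValue ∧
    |vogtValue - 15.97163| < 5 / 10 ^ 6 := by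
  refine ⟨?_, intervalIntegrable_areaIntegrand, ?_, abs_vogtValue_sub_lt⟩
  · rw [surfaceArea_twoDiskHull_eq_integral, integral_rulingArea, vogtValue_eq_integral,
      integral_ellipticIntegrand]
  · rw [integral_areaIntegrand, vogtValue_eq_integral, integral_ellipticIntegrand]
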